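/- **Conventions.** An *index* is a finite tuple $\boldsymbol k=(k_1,\dots,k_r)$ of positive integers ($r\ge 0$), of weight $\mathrm{wt}(\boldsymbol k)=k_1+\cdots+k_r$; it is *admissible* if it is empty or $k_r\ge 2$. For admissible $\boldsymbol k$ let $\zeta(\boldsymbol k)=\sum_{0<n_1<\cdots<n_r}n_1^{-k_1}\cdots n_r^{-k_r}$, with $\zeta(\varnothing)=1$. Let $\mathcal Z$ be the $\mathbb Q$-subalgebra of $\mathbb R$ generated by all these values; note $\pi^2=6\zeta(2)\in\mathcal Z$. Let $\mathfrak H=\mathbb Q\langle x,y\rangle$ and $\mathfrak H^1=\mathbb Q+y\mathfrak H$, which has the $\mathbb Q$-basis $z_{\boldsymbol k}=z_{k_1}\cdots z_{k_r}$ ($\boldsymbol k$ an index), where $z_k=yx^{k-1}$ and $z_\varnothing=1$. The harmonic product $\ast$ on $\mathfrak H^1$ and the shuffle product ш on $\mathfrak H$ are the $\mathbb Q$-bilinear products with unit $1$ such that $$w_1z_a\ast w_2z_b=(w_1\ast w_2z_b)z_a+(w_1z_a\ast w_2)z_b+(w_1\ast w_2)z_{a+b}\qquad(w_1,w_2\in\mathfrak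 H^1,\ a,b\ge 1),$$ $$w_1u_1\,ш\,w_2u_2=(w_1\,ш\,w_2u_2)u_1+(w_1u_1\,ш\,w_2)u_2\qquad(w_1,w_2\in\mathfrak H,\ u_1,u_2\in\{x,y\});$$ ш restricts to $\mathfrak H^1$. For $\bullet\in\{\ast,ш\}$ let $Z^\bullet:\mathfrak H^1\to\mathcal Z[T]$ be the $\mathbb Q$-algebra homomorphism with respect to the product $\bullet$ on $\mathfrak H^1$ such that $Z^\bullet(z_{\boldsymbol k})=\zeta(\boldsymbol k)$ for all admissible $\boldsymbol k$ and $Z^\bullet(y)=T$, and let $\zeta^\bullet(\boldsymbol k)\in\mathcal Z$ be the value of $Z^\bullet(z_{\boldsymbol k})$ at $T=0$. For an index $\boldsymbol k=(k_1,\dots,k_r)$ put $$\zeta^\bullet_{\widehat{\mathcal S}}(\boldsymbol k)=\sum_{i=0}^r(-1)^{k_{i+1}+\cdots+k_r}\,\zeta^\bullet(k_1,\dots,k_i)\sum_{(l_{i+1},\dots,l_r)\in\mathbb Z_{\ge0}^{r-i}}\Bigl(\prod_{j=i+1}^r\binom{k_j+l_j-1}{l_j}\Bigr)\zeta^\bullet(k_r+l_r,\dots,k_{i+1}+l_{i+1})\,t^{\,l_{i+1}+\cdots+l_r}\in\mathcal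 Z[[t]].$$ **Proposition.** For each $\bullet\in\{\ast,ш\}$ the homomorphism $Z^\bullet$ exists and is unique, and for every index $\boldsymbol k$, $$\zeta^\ast_{\widehat{\mathcal S}}(\boldsymbol k)\equiv\zeta^{ш}_{\widehat{\mathcal S}}(\boldsymbol k)\pmod{\pi^2\mathcal Z[[t]]}.$$ Hence the images of $\zeta^\ast_{\widehat{\mathcal S}}(\boldsymbol k)$ and $\zeta^{ш}_{\widehat{\mathcal S}}(\boldsymbol k)$ in $(\mathcal Z/\pi^2\mathcal Z)[[t]]$ coincide, i.e. the $t$-adic symmetric multiple zeta value of $\boldsymbol k$ does not depend on the choice of the regularization. -/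

import Mathlib

open scoped PowerSeries Polynomial

noncomputable section

namespace SymMZV

/-! ### Indices -/

/-- An index: a finite tuple `(k₁, …, k_r)` of positive integers; `[]` is the empty index. -/
abbrev Index := List ℕ+

/-- The weight `k₁ + ⋯ + k_r`. -/
def wt (k : Index) : ℕ := (k.map (fun n => (n : ℕ))).sum

/-- An index is admissible if it is empty or if its last entry is at least `2`. -/
def Admissible (k : Index) : Prop := ∀ a ∈ k.getLast?, 2 ≤ (a : ℕ)

/-- The tuple `k + l`, for an index `k` and a tuple `l` of non-negative integers of the same
length. -/
def Index.shift (k : Index) (l : Fin k.length → ℕ) : Index :=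
  List.ofFn fun j => ⟨(k.get j : ℕ) + l j, Nat.add_pos_left (k.get j).pos _⟩

/-- The product of binomial coefficients `∏ⱼ binom (kⱼ + lⱼ - 1) lⱼ`. -/
def Index.b (k : Index) (l : Fin k.length → ℕ) : ℕ :=
  ∏ j, Nat.choose ((k.get j : ℕ) + l j - 1) (l j)

/-! ### Multiple zeta values and the algebra they generate -/

/-- The multiple zeta value `ζ(k) = ∑_{0 < n₁ < ⋯ < n_r} 1 / (n₁^{k₁} ⋯ n_r^{k_r})`. It is only
used for admissible `k`, for which the series of positive terms converges. For the empty index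
it is `1` (one empty tuple, empty product). -/
def mzv (k : Index) : ℝ :=
  ∑' n : {n : Fin k.length → ℕ // (∀ i, 0 < n i) ∧ StrictMono n},
    ∏ i, 1 / (n.1 i : ℝ) ^ (k.get i : ℕ)

/-- `𝒵`: the `ℚ`-subalgebra of `ℝ` generated by all multiple zeta values. -/
def mzvAlg : Subalgebra ℚ ℝ := Algebra.adjoin ℚ {a | ∃ k, Admissible k ∧ mzv k = a}

/-- `ζ(k)` for admissible `k`, as an element of `𝒵`. -/
def mzvZ (k : Index) (hk : Admissible k) : mzvAlg :=
  ⟨mzv k, Algebra.subset_adjoin ⟨k, hk, rfl⟩⟩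

theorem mzv_two : mzv [2] = Real.pi ^ 2 / 6 := by
  let e : {n : Fin ([2] : Index).length → ℕ // (∀ i, 0 < n i) ∧ StrictMono n} ≃ ℕ :=
    { toFun := fun n => n.1 ⟨0, by simp⟩ - 1
      invFun := fun m => ⟨fun _ => m + 1, fun _ => Nat.succ_pos m, fun i j h => by
        have hi := i.2
        have hj := j.2
        simp only [List.length_singleton] at hi hj
        have : i.1 < j.1 := h
        omega⟩
      left_inv := fun n => by
        apply Subtype.ext
        funext i
        have hi : i = ⟨0, by simp⟩ := by
          apply Fin.ext
          have := i.2
          simp only [List.length_singleton] at this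
          simp only
          omega
        subst hi
        have := n.2.1 ⟨0, by simp⟩
        simp only
        omega
      right_inv := fun m => by simp }
  have h1 : HasSum (fun n : ℕ => 1 / ((n + 1 : ℕ) : ℝ) ^ 2) (Real.pi ^ 2 / 6) := by
    have h := (hasSum_nat_add_iff' (f := fun n : ℕ => (1 : ℝ) / (n : ℝ) ^ 2) 1).2 hasSum_zeta_two
    simpa using h
  rw [mzv, ← e.symm.tsum_eq, ← h1.tsum_eq]
  congr 1
  funext m
  have hu : ∀ f : Fin ([2] : Index).length → ℝ, ∏ i, f i = f ⟨0, by simp⟩ := fun f => by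
    exact Fin.prod_univ_one f
  rw [hu]
  rfl

/-- `π²` as an element of `𝒵`. -/
def piSq : mzvAlg := ⟨Real.pi ^ 2, by
  have h : mzv [2] ∈ mzvAlg := Algebra.subset_adjoin ⟨[2], by simp [Admissible], rfl⟩
  have h6 := mzvAlg.smul_mem h 6
  rw [mzv_two] at h6
  have h7 : (6 : ℚ) • (Real.pi ^ 2 / 6) = Real.pi ^ 2 := by
    rw [Rat.smul_def]
    push_cast
    ring
  rwa [h7] at h6⟩

/-! ### The algebra `ℚ⟨x, y⟩` and the subalgebra `ℚ + y ℚ⟨x, y⟩` -/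

/-- The two letters. -/
inductive Letter
  | x
  | y

/-- `𝔥 = ℚ⟨x, y⟩`. -/
abbrev H := FreeAlgebra ℚ Letter

/-- The variable `x` of `𝔥`. -/
def X : H := FreeAlgebra.ι ℚ Letter.x

/-- The variable `y` of `𝔥`. -/
def Y : H := FreeAlgebra.ι ℚ Letter.y

/-- `𝔥¹ = ℚ + y 𝔥`. -/
def H1 : Subalgebra ℚ H where
  carrier := {w | ∃ (c : ℚ) (v : H), w = algebraMap ℚ H c + Y * v}
  mul_mem' := by
    rintro _ _ ⟨c, v, rfl⟩ ⟨d, u, rfl⟩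
    refine ⟨c * d, c • u + v * (algebraMap ℚ H d + Y * u), ?_⟩
    rw [map_mul, Algebra.smul_def]
    have := (Algebra.commutes c (Y : H))
    simp only [mul_add, add_mul, mul_assoc]
    rw [← mul_assoc Y _ u, ← this, mul_assoc]
    abel
  add_mem' := by
    rintro _ _ ⟨c, v, rfl⟩ ⟨d, u, rfl⟩
    refine ⟨c + d, v + u, ?_⟩
    rw [map_add, mul_add]
    abel
  algebraMap_mem' := fun c => ⟨c, 0, by simp⟩

/-- `z_n = y x^(n-1)`, an element of `𝔥¹`. -/
def zOne (n : ℕ+) : H1 := ⟨Y * X ^ ((n : ℕ) - 1), 0, X ^ ((n : ℕ) - 1), by simp⟩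

/-- `z_k = z_{k₁} ⋯ z_{k_r}`, with `z_∅ = 1`. -/
def z (k : Index) : H1 := (k.map zOne).prod

/-- The monomial of `𝔥` attached to a word. -/
def mono (w : List Letter) : H := (w.map (FreeAlgebra.ι ℚ)).prod

theorem basisFreeMonoid_apply (w : FreeMonoid Letter) :
    FreeAlgebra.basisFreeMonoid ℚ Letter w = mono w.toList := by
  simp [FreeAlgebra.basisFreeMonoid, FreeAlgebra.equivMonoidAlgebraFreeMonoid, mono,
    FreeMonoid.lift_apply]

/-- The word of the monomial `z_k`. -/
def wordOf (k : Index) : List Letter :=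
  (k.map fun n => Letter.y :: List.replicate ((n : ℕ) - 1) Letter.x).flatten

theorem coe_z (k : Index) : ((z k : H1) : H) = mono (wordOf k) := by
  induction k with
  | nil => simp [z, wordOf, mono]
  | cons a k ih =>
    have h : z (a :: k) = zOne a * z k := by simp [z]
    have h2 : wordOf (a :: k)
        = (Letter.y :: List.replicate ((a : ℕ) - 1) Letter.x) ++ wordOf k := by simp [wordOf]
    rw [h, h2, MulMemClass.coe_mul, ih]
    simp [mono, zOne, X, Y, mul_assoc]

theorem wordOf_injective : Function.Injective wordOf := by
  have key : ∀ (m n : ℕ) (k l : Index),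
      List.replicate m Letter.x ++ wordOf k = List.replicate n Letter.x ++ wordOf l →
      m = n ∧ wordOf k = wordOf l := by
    have hx : ∀ (k : Index) (w : List Letter), wordOf k ≠ Letter.x :: w := by
      intro k w
      cases k <;> simp [wordOf]
    intro m
    induction m with
    | zero =>
      intro n k l h
      cases n with
      | zero => simpa using h
      | succ n =>
        rw [List.replicate_succ] at h
        exact absurd h (hx k _)
    | succ m ih =>
      intro n k l h
      cases n with
      | zero =>
        rw [List.replicate_succ] at h
        exact absurd h.symm (hx l _)
      | succ n =>
        rw [List.replicate_succ, List.replicate_succ] at h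
        simp only [List.cons_append, List.cons.injEq, true_and] at h
        obtain ⟨h1, h2⟩ := ih n k l h
        exact ⟨by omega, h2⟩
  intro k
  induction k with
  | nil =>
    intro l h
    cases l with
    | nil => rfl
    | cons b l => simp [wordOf] at h
  | cons a k ih =>
    intro l h
    cases l with
    | nil => simp [wordOf] at h
    | cons b l =>
      have h' : List.replicate ((a : ℕ) - 1) Letter.x ++ wordOf k
          = List.replicate ((b : ℕ) - 1) Letter.x ++ wordOf l := by
        simpa [wordOf] using h
      obtain ⟨h1, h2⟩ := key _ _ _ _ h'
      have ha := a.pos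
      have hb := b.pos
      have hab : a = b := PNat.eq (by omega)
      rw [hab, ih h2]

/-- Every word that begins with `y` is the word of some `z_k`. -/
theorem exists_wordOf (w : List Letter) : ∃ k : Index, wordOf k = Letter.y :: w := by
  suffices h : ∃ (a : ℕ+) (k : Index), wordOf (a :: k) = Letter.y :: w by
    obtain ⟨a, k, h⟩ := h
    exact ⟨_, h⟩
  induction w with
  | nil => exact ⟨1, [], by simp [wordOf]⟩
  | cons u w ih =>
    obtain ⟨a, k, h⟩ := ih
    cases u with
    | x =>
      refine ⟨a + 1, k, ?_⟩
      have ha := a.pos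
      have h' : List.replicate ((a : ℕ) - 1) Letter.x ++ wordOf k = w := by
        simpa [wordOf] using h
      have e : ((a + 1 : ℕ+) : ℕ) - 1 = ((a : ℕ) - 1) + 1 := by
        rw [PNat.add_coe, PNat.one_coe]
        omega
      have : wordOf ((a + 1) :: k)
          = (Letter.y :: List.replicate (((a + 1 : ℕ+) : ℕ) - 1) Letter.x) ++ wordOf k := by
        simp [wordOf]
      rw [this, e, List.replicate_succ, ← h']
      simp
    | y =>
      refine ⟨1, a :: k, ?_⟩
      have : wordOf (1 :: a :: k) = Letter.y :: wordOf (a :: k) := by simp [wordOf]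
      rw [this, h]

theorem linearIndependent_z : LinearIndependent ℚ z := by
  apply LinearIndependent.of_comp H1.val.toLinearMap
  have h := (FreeAlgebra.basisFreeMonoid ℚ Letter).linearIndependent.comp
    (fun k => FreeMonoid.ofList (wordOf k))
    (fun k l h => wordOf_injective (FreeMonoid.ofList.injective h))
  have e : (FreeAlgebra.basisFreeMonoid ℚ Letter : FreeMonoid Letter → H) ∘
      (fun k => FreeMonoid.ofList (wordOf k)) = H1.val.toLinearMap ∘ z := by
    funext k
    simp [basisFreeMonoid_apply, coe_z]
  rwa [e] at h

theorem span_z : ⊤ ≤ Submodule.span ℚ (Set.range z) := by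
  have key : ∀ v : H, Y * v ∈ (Submodule.span ℚ (Set.range z)).map H1.val.toLinearMap := by
    intro v
    have hv : v ∈ Submodule.span ℚ (Set.range (FreeAlgebra.basisFreeMonoid ℚ Letter)) := by
      rw [Module.Basis.span_eq]
      trivial
    induction hv using Submodule.span_induction with
    | zero => simp
    | add a b _ _ ha hb =>
      rw [mul_add]
      exact Submodule.add_mem _ ha hb
    | smul c a _ ha =>
      rw [mul_smul_comm]
      exact Submodule.smul_mem _ _ ha
    | mem a ha =>
      obtain ⟨w, rfl⟩ := ha
      obtain ⟨k, hk⟩ := exists_wordOf w.toList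
      refine ⟨z k, Submodule.subset_span ⟨k, rfl⟩, ?_⟩
      rw [basisFreeMonoid_apply]
      change ((z k : H1) : H) = _
      rw [coe_z, hk]
      simp [mono, Y]
  rintro ⟨w, c, v, rfl⟩ -
  obtain ⟨u, hu, huv⟩ := key v
  have : (⟨algebraMap ℚ H c + Y * v, c, v, rfl⟩ : H1) = c • z [] + u := by
    apply Subtype.ext
    change algebraMap ℚ H c + Y * v = c • ((z [] : H1) : H) + (u : H)
    rw [coe_z, show (u : H) = Y * v from huv, Algebra.algebraMap_eq_smul_one]
    simp [wordOf, mono]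
  rw [this]
  exact Submodule.add_mem _ (Submodule.smul_mem _ _ (Submodule.subset_span ⟨[], rfl⟩)) hu

/-- The monomials `z_k`, for all indices `k`, form a basis of `𝔥¹`. -/
def zBasis : Module.Basis Index ℚ H1 := Module.Basis.mk linearIndependent_z span_z

/-! ### The harmonic product on `𝔥¹` -/

/-- The harmonic product of two monomials `z_k`, each given by the *reversed* list of its
entries, so that the recursion removes the rightmost `z_n`. -/
def harmonicRev : List ℕ+ → List ℕ+ → H1
  | [], l => z l.reverse
  | a :: k, [] => z (a :: k).reverse
  | a :: k, b :: l =>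
      harmonicRev k (b :: l) * zOne a + harmonicRev (a :: k) l * zOne b
        + harmonicRev k l * zOne (a + b)
termination_by k l => k.length + l.length

/-- The harmonic product, as a `ℚ`-bilinear map `𝔥¹ × 𝔥¹ → 𝔥¹`. -/
def harmonic : H1 →ₗ[ℚ] H1 →ₗ[ℚ] H1 :=
  zBasis.constr ℚ fun k => zBasis.constr ℚ fun l => harmonicRev k.reverse l.reverse

theorem harmonic_z (k l : Index) : harmonic (z k) (z l) = harmonicRev k.reverse l.reverse := by
  have h : ∀ k, z k = zBasis k := fun k => by simp [zBasis]
  rw [h, h, harmonic, Module.Basis.constr_basis, Module.Basis.constr_basis]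

theorem harmonic_one_left (l : Index) : harmonic (z []) (z l) = z l := by
  simp [harmonic_z, harmonicRev]

theorem harmonic_one_right (k : Index) : harmonic (z k) (z []) = z k := by
  rw [harmonic_z]
  cases h : k.reverse with
  | nil =>
    have : k = [] := by simpa using h
    simp [harmonicRev, this]
  | cons a k' =>
    have : k = (a :: k').reverse := by rw [← h, List.reverse_reverse]
    simp [harmonicRev, this]

theorem harmonic_mul (k l : Index) (a b : ℕ+) :
    harmonic (z k * zOne a) (z l * zOne b) =
      harmonic (z k) (z l * zOne b) * zOne a + harmonic (z k * zOne a) (z l) * zOne b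
        + harmonic (z k) (z l) * zOne (a + b) := by
  have h : ∀ (k : Index) a, z k * zOne a = z (k ++ [a]) := fun k a => by simp [z]
  simp only [h, harmonic_z, List.reverse_append, List.reverse_singleton, List.singleton_append]
  rw [harmonicRev]

/-! ### The shuffle product on `𝔥` and its restriction to `𝔥¹` -/

/-- The shuffle product of two words, each given by the *reversed* list of its letters, so that
the recursion removes the rightmost letter. -/
def shuffleRev : List Letter → List Letter → H
  | [], v => mono v.reverse
  | a :: u, [] => mono (a :: u).reverse
  | a :: u, b :: v =>
      shuffleRev u (b :: v) * FreeAlgebra.ι ℚ a + shuffleRev (a :: u) v * FreeAlgebra.ι ℚ b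
termination_by u v => u.length + v.length

/-- The shuffle product, as a `ℚ`-bilinear map `𝔥 × 𝔥 → 𝔥`. -/
def shuffle : H →ₗ[ℚ] H →ₗ[ℚ] H :=
  (FreeAlgebra.basisFreeMonoid ℚ Letter).constr ℚ fun u =>
    (FreeAlgebra.basisFreeMonoid ℚ Letter).constr ℚ fun v =>
      shuffleRev u.toList.reverse v.toList.reverse

theorem shuffle_mono (u v : List Letter) :
    shuffle (mono u) (mono v) = shuffleRev u.reverse v.reverse := by
  have hu := basisFreeMonoid_apply (FreeMonoid.ofList u)
  have hv := basisFreeMonoid_apply (FreeMonoid.ofList v)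
  rw [FreeMonoid.toList_ofList] at hu hv
  rw [← hu, ← hv, shuffle, Module.Basis.constr_basis, Module.Basis.constr_basis]
  simp

theorem mono_cons (a : Letter) (u : List Letter) :
    mono (a :: u) = FreeAlgebra.ι ℚ a * mono u := by simp [mono]

theorem shuffle_mul (u v : List Letter) (a b : Letter) :
    shuffle (mono u * FreeAlgebra.ι ℚ a) (mono v * FreeAlgebra.ι ℚ b) =
      shuffle (mono u) (mono v * FreeAlgebra.ι ℚ b) * FreeAlgebra.ι ℚ a
        + shuffle (mono u * FreeAlgebra.ι ℚ a) (mono v) * FreeAlgebra.ι ℚ b := by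
  have h : ∀ (u : List Letter) a, mono u * FreeAlgebra.ι ℚ a = mono (u ++ [a]) :=
    fun u a => by simp [mono]
  simp only [h, shuffle_mono, List.reverse_append, List.reverse_singleton, List.singleton_append]
  rw [shuffleRev]

theorem shuffle_one_left (v : List Letter) : shuffle (mono []) (mono v) = mono v := by
  simp [shuffle_mono, shuffleRev]

theorem shuffle_one_right (u : List Letter) : shuffle (mono u) (mono []) = mono u := by
  rw [shuffle_mono]
  cases h : u.reverse with
  | nil =>
    have : u = [] := by simpa using h
    simp [shuffleRev, this]
  | cons a u' =>
    have : u = (a :: u').reverse := by rw [← h, List.reverse_reverse]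
    simp [shuffleRev, this]

theorem shuffleRev_eq_Y_mul (u v : List Letter) (hu : u.getLast? ≠ some Letter.x)
    (hv : v.getLast? ≠ some Letter.x) (h : u ≠ [] ∨ v ≠ []) :
    ∃ w, shuffleRev u v = Y * w := by
  have base : ∀ v : List Letter, v.getLast? ≠ some Letter.x → v ≠ [] →
      ∃ w, mono v.reverse = Y * w := by
    intro v hv hne
    obtain ⟨v', c, rfl⟩ := (List.eq_nil_or_concat v).resolve_left hne
    cases c with
    | x => simp at hv
    | y => exact ⟨mono v'.reverse, by simp [mono_cons, Y]⟩
  have tail : ∀ (a : Letter) (u : List Letter), (a :: u).getLast? ≠ some Letter.x →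
      u.getLast? ≠ some Letter.x := by
    intro a u hu
    cases u with
    | nil => simp
    | cons b u => rwa [List.getLast?_cons_cons] at hu
  induction u, v using shuffleRev.induct with
  | case1 v =>
    rw [shuffleRev]
    exact base v hv (by simpa using h)
  | case2 a u =>
    rw [shuffleRev]
    exact base _ hu (by simp)
  | case3 a u b v ih1 ih2 =>
    obtain ⟨w1, h1⟩ := ih1 (tail a u hu) hv (by simp)
    obtain ⟨w2, h2⟩ := ih2 hu (tail b v hv) (by simp)
    rw [shuffleRev, h1, h2]
    exact ⟨w1 * FreeAlgebra.ι ℚ a + w2 * FreeAlgebra.ι ℚ b, by rw [mul_add, mul_assoc, mul_assoc]⟩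

theorem wordOf_head (k : Index) : (wordOf k).reverse.getLast? ≠ some Letter.x := by
  cases k <;> simp [wordOf]

theorem shuffle_mem (w₁ w₂ : H1) : shuffle (w₁ : H) (w₂ : H) ∈ H1 := by
  have h1 : w₁ ∈ Submodule.span ℚ (Set.range z) := span_z trivial
  have h2 : w₂ ∈ Submodule.span ℚ (Set.range z) := span_z trivial
  induction h1, h2 using Submodule.span_induction₂ with
  | mem_mem a b ha hb =>
    obtain ⟨k, rfl⟩ := ha
    obtain ⟨l, rfl⟩ := hb
    rw [coe_z, coe_z, shuffle_mono]
    by_cases h : (wordOf k).reverse ≠ [] ∨ (wordOf l).reverse ≠ []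
    · obtain ⟨w, hw⟩ := shuffleRev_eq_Y_mul _ _ (wordOf_head k) (wordOf_head l) h
      rw [hw]
      exact ⟨0, w, by simp⟩
    · push Not at h
      rw [h.1, h.2, shuffleRev]
      simp [mono]
  | zero_left b hb => simp
  | zero_right a ha => simp
  | add_left a b c _ _ _ h1 h2 => simpa using H1.add_mem h1 h2
  | add_right a b c _ _ _ h1 h2 => simpa using H1.add_mem h1 h2
  | smul_left r a b _ _ h => simpa using H1.smul_mem h r
  | smul_right r a b _ _ h => simpa using H1.smul_mem h r

/-- The restriction of the shuffle product to `𝔥¹`. -/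
def shuffleH1 : H1 →ₗ[ℚ] H1 →ₗ[ℚ] H1 :=
  LinearMap.mk₂ ℚ (fun w₁ w₂ => ⟨shuffle (w₁ : H) (w₂ : H), shuffle_mem w₁ w₂⟩)
    (fun a b c => Subtype.ext (by simp)) (fun r a b => Subtype.ext (by simp))
    (fun a b c => Subtype.ext (by simp)) (fun r a b => Subtype.ext (by simp))

/-! ### Regularized multiple zeta values -/

/-- The two symbols `•`. -/
inductive Kind
  | harmonic
  | shuffle

/-- The product `•` on `𝔥¹`. -/
def Kind.prod : Kind → (H1 →ₗ[ℚ] H1 →ₗ[ℚ] H1)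
  | .harmonic => SymMZV.harmonic
  | .shuffle => shuffleH1

/-- `Z : 𝔥¹ → 𝒵[T]` is a homomorphism of `ℚ`-algebras from `𝔥¹` with the product `•` to `𝒵[T]`,
it extends `z_k ↦ ζ(k)` (`k` admissible), and it sends `y = z_1` to `T`. -/
structure IsRegularization (s : Kind) (Z : H1 →ₗ[ℚ] mzvAlg[X]) : Prop where
  map_one : Z 1 = 1
  map_prod : ∀ w₁ w₂ : H1, Z (s.prod w₁ w₂) = Z w₁ * Z w₂
  map_admissible : ∀ (k : Index) (hk : Admissible k), Z (z k) = Polynomial.C (mzvZ k hk)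
  map_y : Z (z [1]) = Polynomial.X

/-- The homomorphism `Z^•`, i.e. the one map (existence and uniqueness are theorems) that
satisfies `IsRegularization`. -/
def regHom (s : Kind) : H1 →ₗ[ℚ] mzvAlg[X] := Classical.epsilon (IsRegularization s)

/-- The polynomial `ζ^•(k; T) = Z^•(z_k)`. -/
def zetaRegPoly (s : Kind) (k : Index) : mzvAlg[X] := regHom s (z k)

/-- The regularized multiple zeta value `ζ^•(k) = ζ^•(k; 0)`. -/
def zetaReg (s : Kind) (k : Index) : mzvAlg := (zetaRegPoly s k).eval 0

/-! ### The `t`-adic symmetric multiple zeta values -/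

/-- The series `∑_l b(k, l) ζ^•(reverse of k + l) t^{wt l}`, with `l` running through all tuples
of non-negative integers of the length of `k`; `antidiagonalTuple r n` is the finite set of the
tuples in `ℕ^r` with sum `n`. -/
def tailSeries (s : Kind) (k : Index) : mzvAlg⟦X⟧ :=
  PowerSeries.mk fun n => ∑ l ∈ Finset.Nat.antidiagonalTuple k.length n,
    (k.b l : mzvAlg) * zetaReg s (k.shift l).reverse

/-- `ζ^•_Ŝ(k) = ∑_{i=0}^r (-1)^{wt(k^{[i]})} ζ^•(k_{[i]}) ∑_l b(k^{[i]}, l)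
ζ^•(reverse of k^{[i]} + l) t^{wt l}`, where `k_{[i]} = (k₁, …, k_i)` and
`k^{[i]} = (k_{i+1}, …, k_r)`. -/
def zetaS (s : Kind) (k : Index) : mzvAlg⟦X⟧ :=
  ∑ i ∈ Finset.range (k.length + 1),
    (-1) ^ wt (k.drop i) * PowerSeries.C (zetaReg s (k.take i)) * tailSeries s (k.drop i)

/-- `π² 𝒵`, as an ideal of `𝒵`. -/
def piSqIdeal : Ideal mzvAlg := Ideal.span {piSq}

/-- `π² 𝒵⟦t⟧`, as an ideal of `𝒵⟦t⟧`. -/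
def piSqIdealSeries : Ideal mzvAlg⟦X⟧ := Ideal.span {PowerSeries.C piSq}

/-- The image of `ζ^•_Ŝ(k)` in `(𝒵/π²𝒵)⟦t⟧`. -/
def zetaSBar (s : Kind) (k : Index) : (mzvAlg ⧸ piSqIdeal)⟦X⟧ :=
  PowerSeries.map (Ideal.Quotient.mk piSqIdeal) (zetaS s k)

end SymMZV

end

namespace SymMZV

/-! For either product, removing a trailing y (the map `del`) satisfies del(w • y) = del(w) • y + w.
It is locally nilpotent and kills exactly the span of the admissible monomials. So 𝔥¹ is obtained
from that span by repeated products with y (`mem_of_admissible_of_prod_y`). This gives uniqueness of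
Z^•, and shows that `del` corresponds to d/dT.

Existence is analytic. Truncated sums are multiplicative for ∗. Polylogarithms at 1 - 1/(m+1) are
multiplicative for ш. At admissible monomials both converge with error O(m^(-1/2)), while at y they
equal the harmonic number, respectively log(m+1). Each w therefore has a unique asymptotic
polynomial in the divergent quantity, and this polynomial is Z^•(w).

The truncated sums are the partial sums of the polylogarithm coefficients, so Abel's theorem carries
linear relations with constant coefficients from Z^∗ to Z^ш (`regHom_shuffle_eq_sum`). Integrating
d/dT = `del` step by step, and fixing each constant of integration on the shuffle side, where yʲ
with j ≥ 1 vanishes at T = 0, gives ζ^∗(k) = ∑ⱼ aⱼ ζ^ш(k without j trailing ones) with aⱼ = ζ^∗(1,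
…, 1) (`zetaReg_harmonic_eq_conv`).

In the symmetric sum this correction acts on both sides of each cut, always on the entries next to
the cut. Moving a 1 across the cut changes the sign, so the total correction has coefficients
∑_{p+q=n} (-1)^q a_p a_q, those of F(u)F(-u) with F = ∑ aⱼ uʲ (`cutSum_conv`). By Newton's identity
the logarithmic derivative of F(u)F(-u) involves only zeta values at even integers, which are
multiples of π² by Euler. Hence F(u)F(-u) ≡ 1 modulo π² (`sum_regOnes_mem`). The series in t does
not interfere, since a shifted entry equals 1 only if it was 1 and was not shifted
(`shiftSeries_conv`). -/

theorem zBasis_apply (k : Index) : zBasis k = z k := by simp [zBasis]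

theorem z_append (k l : Index) : z (k ++ l) = z k * z l := by simp [z]

theorem z_singleton (a : ℕ+) : z [a] = zOne a := by simp [z]

theorem z_nil : z [] = 1 := rfl

theorem z_reverse_cons (a : ℕ+) (r : List ℕ+) :
    z (a :: r).reverse = z r.reverse * zOne a := by
  rw [List.reverse_cons, z_append, z_singleton]

/-- Monomials are indexed by reversed lists, so that the last entry, on which all the recursions
act, is the head of the list. -/
theorem H1_induction {P : H1 → Prop} (hz : ∀ r : List ℕ+, P (z r.reverse))
    (hadd : ∀ u v, P u → P v → P (u + v)) (hsmul : ∀ (c : ℚ) u, P u → P (c • u)) (w : H1) :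
    P w := by
  have hw : w ∈ Submodule.span ℚ (Set.range z) := span_z trivial
  induction hw using Submodule.span_induction with
  | mem a ha =>
    obtain ⟨k, rfl⟩ := ha
    simpa using hz k.reverse
  | zero => simpa using hsmul 0 _ (hz [])
  | add u v _ _ hu hv => exact hadd u v hu hv
  | smul c u _ hu => exact hsmul c u hu

/-! ### Removal of a trailing `y` -/

/-- `delRev r` is `z_k` if `r` is the reversal of `(k, 1)`, and `0` otherwise. -/
noncomputable def delRev : List ℕ+ → H1
  | [] => 0
  | a :: r => if a = 1 then z r.reverse else 0

/-- The linear map `w y ↦ w`, `w x ↦ 0`, `1 ↦ 0` of `𝔥¹`. -/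
noncomputable def del : H1 →ₗ[ℚ] H1 := zBasis.constr ℚ fun k => delRev k.reverse

theorem del_z (r : List ℕ+) : del (z r.reverse) = delRev r := by
  rw [← zBasis_apply, del, Module.Basis.constr_basis, List.reverse_reverse]

theorem del_mul_zOne (w : H1) (a : ℕ+) : del (w * zOne a) = if a = 1 then w else 0 := by
  induction w using H1_induction with
  | hz r => rw [← z_reverse_cons, del_z, delRev]
  | hadd u v hu hv => rw [add_mul, map_add, hu, hv]; split <;> simp
  | hsmul c u hu => rw [smul_mul_assoc, map_smul, hu]; split <;> simp

theorem del_one : del 1 = 0 := by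
  rw [← z_nil]; exact del_z []

/-- The linear map `w y ↦ w`, `w x ↦ 0`, `1 ↦ 0` of `𝔥`. -/
noncomputable def delH : H →ₗ[ℚ] H :=
  (FreeAlgebra.basisFreeMonoid ℚ Letter).constr ℚ fun u =>
    match u.toList.reverse with
    | [] => 0
    | Letter.x :: _ => 0
    | Letter.y :: v => mono v.reverse

theorem H_induction {P : H → Prop} (hmono : ∀ u : List Letter, P (mono u.reverse))
    (hadd : ∀ u v, P u → P v → P (u + v)) (hsmul : ∀ (c : ℚ) u, P u → P (c • u)) (w : H) :
    P w := by
  have hw : w ∈ Submodule.span ℚ (Set.range (FreeAlgebra.basisFreeMonoid ℚ Letter)) := by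
    rw [Module.Basis.span_eq]; trivial
  induction hw using Submodule.span_induction with
  | mem a ha =>
    obtain ⟨k, rfl⟩ := ha
    rw [basisFreeMonoid_apply]
    simpa using hmono k.toList.reverse
  | zero => simpa using hsmul 0 _ (hmono [])
  | add u v _ _ hu hv => exact hadd u v hu hv
  | smul c u _ hu => exact hsmul c u hu

theorem constr_mono {M : Type*} [AddCommMonoid M] [Module ℚ M] (f : FreeMonoid Letter → M)
    (u : List Letter) :
    (FreeAlgebra.basisFreeMonoid ℚ Letter).constr ℚ f (mono u) = f (FreeMonoid.ofList u) := by
  rw [← FreeMonoid.toList_ofList u, ← basisFreeMonoid_apply, Module.Basis.constr_basis]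
  rfl

theorem mono_reverse_cons (a : Letter) (u : List Letter) :
    mono (a :: u).reverse = mono u.reverse * FreeAlgebra.ι ℚ a := by
  simp [mono]

theorem delH_mul_x (w : H) : delH (w * FreeAlgebra.ι ℚ Letter.x) = 0 := by
  induction w using H_induction with
  | hmono u => rw [← mono_reverse_cons, delH, constr_mono]; simp
  | hadd u v hu hv => rw [add_mul, map_add, hu, hv, add_zero]
  | hsmul c u hu => rw [smul_mul_assoc, map_smul, hu, smul_zero]

theorem delH_mul_y (w : H) : delH (w * FreeAlgebra.ι ℚ Letter.y) = w := by
  induction w using H_induction with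
  | hmono u => rw [← mono_reverse_cons, delH, constr_mono]; simp
  | hadd u v hu hv => rw [add_mul, map_add, hu, hv]
  | hsmul c u hu => rw [smul_mul_assoc, map_smul, hu]

theorem delH_one : delH 1 = 0 := by
  have : (1 : H) = mono [] := by simp [mono]
  rw [this, delH, constr_mono]; simp

/-- The word of z_a ends in y exactly when a = 1. This gives access to the shuffle product, whose
recursion runs over letters and not over the z_a. -/
theorem coe_del (w : H1) : ((del w : H1) : H) = delH (w : H) := by
  induction w using H1_induction with
  | hz r =>
    cases r with
    | nil => simp [z_nil, del_one, delH_one]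
    | cons a r =>
      rw [z_reverse_cons, del_mul_zOne, MulMemClass.coe_mul]
      by_cases ha : a = 1
      · subst ha
        have : ((zOne 1 : H1) : H) = FreeAlgebra.ι ℚ Letter.y := by simp [zOne, Y]
        rw [this, delH_mul_y]; simp
      · have h1 : 1 < (a : ℕ) := by
          rcases Nat.lt_or_ge 1 a with h | h
          · exact h
          · exact absurd (PNat.coe_eq_one_iff.1 (le_antisymm h a.pos)) ha
        obtain ⟨n, hn⟩ : ∃ n, (a : ℕ) - 1 = n + 1 := ⟨(a : ℕ) - 2, by omega⟩
        have : ((zOne a : H1) : H) = Y * X ^ n * FreeAlgebra.ι ℚ Letter.x := by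
          simp [zOne, hn, pow_succ, X, mul_assoc]
        rw [this, ← mul_assoc, delH_mul_x]
        simp [ha]
  | hadd u v hu hv => simp [hu, hv]
  | hsmul c u hu => simp [hu]

theorem coe_z_one : ((z [1] : H1) : H) = mono [Letter.y] := by
  rw [coe_z]; rfl

/-- In the recursion for w ш y, the last letter is either the new y, which contributes w, or the
last letter of w, which contributes only if it is a y. -/
theorem delH_shuffle_y (w : H) :
    delH (shuffle w (mono [Letter.y])) = shuffle (delH w) (mono [Letter.y]) + w := by
  induction w using H_induction with
  | hmono u =>
    have hm : mono [] = (1 : H) := by simp [mono]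
    cases u with
    | nil =>
      rw [List.reverse_nil, shuffle_one_left, hm, delH_one]
      have : mono [Letter.y] = 1 * FreeAlgebra.ι ℚ Letter.y := by simp [mono]
      rw [this, delH_mul_y]; simp
    | cons a u =>
      have h := shuffle_mul u.reverse [] a Letter.y
      rw [← mono_reverse_cons, hm, one_mul, ← hm, shuffle_one_right] at h
      have hy : FreeAlgebra.ι ℚ Letter.y = mono [Letter.y] := by simp [mono]
      rw [hy] at h
      rw [h, map_add, ← hy, delH_mul_y, mono_reverse_cons]
      cases a with
      | x => rw [delH_mul_x, delH_mul_x]; simp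
      | y => rw [delH_mul_y, delH_mul_y]
  | hadd u v hu hv => simp only [map_add, LinearMap.add_apply, hu, hv]; abel
  | hsmul c u hu => simp only [map_smul, LinearMap.smul_apply, hu, smul_add]

theorem harmonic_mul_right_one (w : H1) (a : ℕ+) :
    harmonic (w * zOne a) (z [1]) =
      harmonic w (z [1]) * zOne a + w * zOne a * zOne 1 + w * zOne (a + 1) := by
  induction w using H1_induction with
  | hz r =>
    have h := harmonic_mul r.reverse [] a 1
    rw [z_nil, one_mul, ← z_singleton 1, ← z_nil, harmonic_one_right, ← z_reverse_cons,
      harmonic_one_right] at h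
    rw [← z_reverse_cons, h, z_singleton]
  | hadd u v hu hv => simp only [add_mul, map_add, LinearMap.add_apply, hu, hv]; abel
  | hsmul c u hu => simp only [smul_mul_assoc, map_smul, LinearMap.smul_apply, hu, smul_add]

/-- `del` behaves like a derivation on products with `y`, for both products. -/
theorem del_prod_y (s : Kind) (w : H1) :
    del (s.prod w (z [1])) = s.prod (del w) (z [1]) + w := by
  cases s with
  | harmonic =>
    change del (harmonic w (z [1])) = harmonic (del w) (z [1]) + w
    induction w using H1_induction with
    | hz r =>
      cases r with
      | nil =>
        rw [List.reverse_nil, harmonic_one_left, z_nil, del_one, z_singleton]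
        have := del_mul_zOne 1 1
        rw [one_mul] at this
        simp [this]
      | cons a r =>
        -- The contracted term of the harmonic product ends in an entry at least 2, so `del` kills
        -- it.
        have ha : a + 1 ≠ 1 := by
          intro h
          have := congrArg PNat.val h
          have := a.pos
          simp at *
        rw [z_reverse_cons, harmonic_mul_right_one, map_add, map_add, del_mul_zOne, del_mul_zOne,
          del_mul_zOne, del_mul_zOne, if_neg ha]
        by_cases h : a = 1 <;> simp [h]
    | hadd u v hu hv => simp only [map_add, LinearMap.add_apply, hu, hv]; abel
    | hsmul c u hu => simp only [map_smul, LinearMap.smul_apply, hu, smul_add]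
  | shuffle =>
    apply Subtype.ext
    change ((del (shuffleH1 w (z [1])) : H1) : H) = shuffle ((del w : H1) : H) (z [1] : H1) + w
    rw [coe_del, coe_del, coe_z_one]
    change delH (shuffle (w : H) (z [1] : H1)) = _
    rw [coe_z_one, delH_shuffle_y]

theorem exists_del_pow_eq_zero (w : H1) : ∃ m : ℕ, (del ^ m) w = 0 := by
  have hle : ∀ (w : H1) (m n : ℕ), m ≤ n → (del ^ m) w = 0 → (del ^ n) w = 0 := by
    intro w m n hmn h
    obtain ⟨c, rfl⟩ := Nat.exists_eq_add_of_le hmn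
    rw [add_comm, pow_add, Module.End.mul_apply, h, map_zero]
  induction w using H1_induction with
  | hz r =>
    induction r with
    | nil => exact ⟨1, by simp [z_nil, del_one]⟩
    | cons a r ih =>
      obtain ⟨m, hm⟩ := ih
      refine ⟨m + 1, ?_⟩
      rw [pow_succ, Module.End.mul_apply, z_reverse_cons, del_mul_zOne]
      split
      · exact hm
      · simp
  | hadd u v hu hv =>
    obtain ⟨m, hm⟩ := hu
    obtain ⟨n, hn⟩ := hv
    refine ⟨max m n, ?_⟩
    rw [map_add, hle u m _ (le_max_left _ _) hm, hle v n _ (le_max_right _ _) hn, add_zero]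
  | hsmul c u hu =>
    obtain ⟨m, hm⟩ := hu
    exact ⟨m, by rw [map_smul, hm, smul_zero]⟩

theorem admissible_reverse_cons (a : ℕ+) (r : List ℕ+) :
    Admissible (a :: r).reverse ↔ a ≠ 1 := by
  have : (2 ≤ (a : ℕ)) ↔ a ≠ 1 := by
    rw [Ne, ← PNat.coe_eq_one_iff]
    have := a.pos
    omega
  simp [Admissible, this]

/-- The component of `w` without trailing `y`. -/
theorem sub_del_mul_mem (w : H1) :
    w - del w * zOne 1 ∈ Submodule.span ℚ {u | ∃ k, Admissible k ∧ z k = u} := by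
  induction w using H1_induction with
  | hz r =>
    cases r with
    | nil =>
      rw [List.reverse_nil, z_nil, del_one, zero_mul, sub_zero]
      exact Submodule.subset_span ⟨[], by simp [Admissible], z_nil⟩
    | cons a r =>
      by_cases h : a = 1
      · subst h
        rw [z_reverse_cons, del_mul_zOne]; simp
      · rw [z_reverse_cons, del_mul_zOne, if_neg h, zero_mul, sub_zero, ← z_reverse_cons]
        exact Submodule.subset_span ⟨_, (admissible_reverse_cons a r).2 h, rfl⟩
  | hadd u v hu hv =>
    rw [map_add, add_mul, add_sub_add_comm]
    exact Submodule.add_mem _ hu hv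
  | hsmul c u hu =>
    rw [map_smul, smul_mul_assoc, ← smul_sub]
    exact Submodule.smul_mem _ _ hu

/-- `𝔥¹` is generated by the admissible monomials under products with `y`. -/
theorem mem_of_admissible_of_prod_y (s : Kind) (V : Submodule ℚ H1)
    (hadm : ∀ k, Admissible k → z k ∈ V) (hy : ∀ w ∈ V, s.prod w (z [1]) ∈ V) (w : H1) :
    w ∈ V := by
  have hker : ∀ u : H1, del u = 0 → u ∈ V := by
    intro u hu
    have h := sub_del_mul_mem u
    rw [hu, zero_mul, sub_zero] at h
    refine (Submodule.span_le.2 ?_) h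
    rintro _ ⟨k, hk, rfl⟩
    exact hadm k hk
  let p : H1 → H1 := fun u => s.prod u (z [1])
  -- On v • y • ⋯ • y with `del v = 0`, `del` acts like d/dT on v Tᵐ.
  have hp : ∀ (m : ℕ) (v : H1), del v = 0 → del (p^[m + 1] v) = (m + 1 : ℚ) • p^[m] v := by
    intro m v hv
    induction m with
    | zero => simp [p, del_prod_y, hv]
    | succ m ih =>
      rw [Function.iterate_succ_apply' p (m + 1)]
      change del (s.prod (p^[m + 1] v) (z [1])) = _
      rw [del_prod_y, ih, map_smul, LinearMap.smul_apply]
      change (m + 1 : ℚ) • p (p^[m] v) + _ = _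
      rw [← Function.iterate_succ_apply' p m]
      simp only [Nat.succ_eq_add_one]
      push_cast
      module
  have hpow : ∀ (m : ℕ) (v : H1), del v = 0 → (del ^ m) (p^[m] v) = (m.factorial : ℚ) • v := by
    intro m v hv
    induction m with
    | zero => simp
    | succ m ih =>
      rw [pow_succ, Module.End.mul_apply, hp m v hv, map_smul, ih, smul_smul, Nat.factorial_succ]
      push_cast
      rfl
  have hpV : ∀ (m : ℕ) (v : H1), v ∈ V → p^[m] v ∈ V := by
    intro m v hv
    induction m with
    | zero => exact hv
    | succ m ih => rw [Function.iterate_succ_apply']; exact hy _ ih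
  obtain ⟨m, hm⟩ := exists_del_pow_eq_zero w
  induction m generalizing w with
  | zero =>
    have : w = 0 := hm
    rw [this]; exact V.zero_mem
  | succ m ih =>
    have hv : del ((del ^ m) w) = 0 := by
      rwa [pow_succ', Module.End.mul_apply] at hm
    set v := (del ^ m) w
    have hf : (m.factorial : ℚ) ≠ 0 := by positivity
    -- Subtracting the top term v Tᵐ / m! of the Taylor expansion lowers the order of nilpotency; v
    -- itself lies in the kernel of `del`.
    have h0 : (del ^ m) (w - (m.factorial : ℚ)⁻¹ • p^[m] v) = 0 := by
      rw [map_sub, map_smul, hpow m v hv, smul_smul, inv_mul_cancel₀ hf, one_smul, sub_self]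
    have := V.add_mem (ih _ h0) (V.smul_mem (m.factorial : ℚ)⁻¹ (hpV m v (hker v hv)))
    simpa using this


/-! ### Truncated multiple zeta values -/

/-- The truncated multiple zeta value `∑_{0 < n₁ < ⋯ < n_r ≤ N} ∏ 1 / nᵢ^{kᵢ}` of the index whose
reversal is the given list. -/
noncomputable def hsum : List ℕ+ → ℕ → ℝ
  | [], _ => 1
  -- The largest summation variable is m + 1, so the others are at most m.
  | a :: r, N => ∑ m ∈ Finset.range N, hsum r m / ((m : ℝ) + 1) ^ (a : ℕ)

theorem hsum_nil (N : ℕ) : hsum [] N = 1 := rfl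

theorem hsum_cons_zero (a : ℕ+) (r : List ℕ+) : hsum (a :: r) 0 = 0 := by simp [hsum]

theorem hsum_cons_succ (a : ℕ+) (r : List ℕ+) (N : ℕ) :
    hsum (a :: r) (N + 1) = hsum (a :: r) N + hsum r N / ((N : ℝ) + 1) ^ (a : ℕ) := by
  simp [hsum, Finset.sum_range_succ]

theorem hsum_nonneg (r : List ℕ+) (N : ℕ) : 0 ≤ hsum r N := by
  induction r generalizing N with
  | nil => simp [hsum]
  | cons a r ih => exact Finset.sum_nonneg fun m _ => div_nonneg (ih m) (by positivity)

/-- The truncated multiple zeta values as linear maps on `𝔥¹`. -/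
noncomputable def trunc (N : ℕ) : H1 →ₗ[ℚ] ℝ := zBasis.constr ℚ fun k => hsum k.reverse N

theorem trunc_z (N : ℕ) (r : List ℕ+) : trunc N (z r.reverse) = hsum r N := by
  rw [← zBasis_apply, trunc, Module.Basis.constr_basis, List.reverse_reverse]

theorem trunc_one (N : ℕ) : trunc N 1 = 1 := trunc_z N []

theorem trunc_zero_mul (w : H1) (a : ℕ+) : trunc 0 (w * zOne a) = 0 := by
  induction w using H1_induction with
  | hz r => rw [← z_reverse_cons, trunc_z, hsum_cons_zero]
  | hadd u v hu hv => rw [add_mul, map_add, hu, hv, add_zero]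
  | hsmul c u hu => rw [smul_mul_assoc, map_smul, hu, smul_zero]

theorem trunc_succ_mul (N : ℕ) (w : H1) (a : ℕ+) :
    trunc (N + 1) (w * zOne a) = trunc N (w * zOne a) + trunc N w / ((N : ℝ) + 1) ^ (a : ℕ) := by
  induction w using H1_induction with
  | hz r => rw [← z_reverse_cons, trunc_z, trunc_z, trunc_z, hsum_cons_succ]
  | hadd u v hu hv => simp only [add_mul, map_add, hu, hv, add_div]; ring
  | hsmul c u hu =>
    simp only [smul_mul_assoc, map_smul, hu, smul_add, Rat.smul_def]
    ring

/-- Both sides vanish at N = 0 when both lists are nonempty. The increment of a product, (K + α)(L +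
β) - KL = αL + Kβ + αβ, matches the three terms of the recursion. -/
theorem trunc_harmonicRev (k l : List ℕ+) (N : ℕ) :
    trunc N (harmonicRev k l) = hsum k N * hsum l N := by
  induction k, l using harmonicRev.induct generalizing N with
  | case1 l => rw [harmonicRev, trunc_z, hsum_nil, one_mul]
  | case2 a k => rw [harmonicRev, trunc_z, hsum_nil, mul_one]
  | case3 a k b l ih1 ih2 ih3 =>
    rw [harmonicRev, map_add, map_add]
    induction N with
    | zero => simp only [trunc_zero_mul, hsum_cons_zero]; ring
    | succ N ih =>
      have hN : ((N : ℝ) + 1) ≠ 0 := by positivity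
      rw [trunc_succ_mul, trunc_succ_mul, trunc_succ_mul, ih1, ih2, ih3, hsum_cons_succ,
        hsum_cons_succ]
      have e : ∀ A B C D E F : ℝ, A + D + (B + E) + (C + F) = (A + B + C) + (D + E + F) := by
        intros; ring
      rw [e, ih, PNat.add_coe, pow_add]
      field_simp
      ring

theorem trunc_harmonic (N : ℕ) (u v : H1) :
    trunc N (harmonic u v) = trunc N u * trunc N v := by
  induction u using H1_induction with
  | hz r =>
    induction v using H1_induction with
    | hz t => rw [harmonic_z, List.reverse_reverse, List.reverse_reverse, trunc_harmonicRev,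
        trunc_z, trunc_z]
    | hadd u v hu hv => simp only [map_add, hu, hv, mul_add]
    | hsmul c u hu => simp only [map_smul, hu, mul_smul_comm]
  | hadd u v hu hv => simp only [map_add, LinearMap.add_apply, hu, hv, add_mul]
  | hsmul c u hu => simp only [map_smul, LinearMap.smul_apply, hu, smul_mul_assoc]


/-! ### The operator `t d/dt` on power series -/

/-- The operator `t d/dt` on power series. -/
noncomputable def theta {R : Type*} [CommRing R] (f : R⟦X⟧) : R⟦X⟧ :=
  PowerSeries.mk fun n => n * PowerSeries.coeff n f

theorem coeff_theta {R : Type*} [CommRing R] (f : R⟦X⟧) (n : ℕ) :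
    PowerSeries.coeff n (theta f) = n * PowerSeries.coeff n f := by
  rw [theta, PowerSeries.coeff_mk]

theorem theta_mul {R : Type*} [CommRing R] (f g : R⟦X⟧) :
    theta (f * g) = theta f * g + f * theta g := by
  ext n
  rw [coeff_theta, map_add, PowerSeries.coeff_mul, PowerSeries.coeff_mul, PowerSeries.coeff_mul,
    Finset.mul_sum, ← Finset.sum_add_distrib]
  refine Finset.sum_congr rfl fun p hp => ?_
  rw [← Finset.HasAntidiagonal.mem_antidiagonal.1 hp, coeff_theta, coeff_theta]
  push_cast
  ring

theorem coeff_zero_mul {R : Type*} [CommRing R] (f g : R⟦X⟧) :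
    PowerSeries.coeff 0 (f * g) = PowerSeries.coeff 0 f * PowerSeries.coeff 0 g := by simp

theorem eq_of_theta_eq {f g : ℝ⟦X⟧} (h0 : PowerSeries.coeff 0 f = PowerSeries.coeff 0 g)
    (h : theta f = theta g) : f = g := by
  ext n
  cases n with
  | zero => exact h0
  | succ n =>
    have := congrArg (PowerSeries.coeff (n + 1)) h
    rw [coeff_theta, coeff_theta] at this
    exact mul_left_cancel₀ (by positivity) this

/-! ### Multiple polylogarithms as power series -/

/-- The differential form attached to a letter, relative to `dt / t`. -/
noncomputable def letterSeries : Letter → ℝ⟦X⟧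
  | Letter.x => 1
  | Letter.y => PowerSeries.X * PowerSeries.mk 1

/-- Integration from `0` against the differential form attached to a letter. -/
noncomputable def integ (a : Letter) (f : ℝ⟦X⟧) : ℝ⟦X⟧ :=
  PowerSeries.mk fun n => PowerSeries.coeff n (letterSeries a * f) / n

theorem integ_add (a : Letter) (f g : ℝ⟦X⟧) : integ a (f + g) = integ a f + integ a g := by
  ext n
  simp [integ, mul_add, add_div]

theorem integ_smul (a : Letter) (c : ℚ) (f : ℝ⟦X⟧) : integ a (c • f) = c • integ a f := by
  ext n
  rw [integ, PowerSeries.coeff_mk, mul_smul_comm, PowerSeries.coeff_smul, PowerSeries.coeff_smul,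
    integ, PowerSeries.coeff_mk, smul_div_assoc]

/-- The constant coefficient is a division by 0, hence 0; this is the normalization of an integral
starting at 0. -/
theorem coeff_zero_integ (a : Letter) (f : ℝ⟦X⟧) : PowerSeries.coeff 0 (integ a f) = 0 := by
  rw [integ, PowerSeries.coeff_mk]
  simp

theorem coeff_integ_x (f : ℝ⟦X⟧) (n : ℕ) :
    PowerSeries.coeff n (integ Letter.x f) = PowerSeries.coeff n f / n := by
  rw [integ, PowerSeries.coeff_mk, letterSeries, one_mul]

theorem coeff_succ_integ_y (f : ℝ⟦X⟧) (n : ℕ) :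
    PowerSeries.coeff (n + 1) (integ Letter.y f) =
      (∑ i ∈ Finset.range (n + 1), PowerSeries.coeff i f) / ((n : ℝ) + 1) := by
  rw [integ, PowerSeries.coeff_mk, letterSeries, mul_assoc, PowerSeries.coeff_succ_X_mul,
    mul_comm, PowerSeries.coeff_mul, Finset.Nat.sum_antidiagonal_eq_sum_range_succ_mk]
  simp

/-- Division by n loses the constant term, so `theta` undoes the integration only if the integrand
has none. -/
theorem theta_integ (a : Letter) (f : ℝ⟦X⟧)
    (h : PowerSeries.coeff 0 (letterSeries a * f) = 0) :
    theta (integ a f) = letterSeries a * f := by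
  ext n
  rw [coeff_theta, integ, PowerSeries.coeff_mk]
  rcases Nat.eq_zero_or_pos n with rfl | hn
  · rw [h]; simp
  · have : (n : ℝ) ≠ 0 := by positivity
    field_simp

/-- The power series of the multiple polylogarithm of a word, given by its reversal. -/
noncomputable def polylogRev : List Letter → ℝ⟦X⟧
  | [] => 1
  | a :: u => integ a (polylogRev u)

/-- If the word starts with y, the form dt/t is never integrated against a nonzero constant, so no
logarithm of t appears. -/
theorem coeff_zero_letterSeries_mul_polylogRev (a : Letter) (u : List Letter)
    (h : (a :: u).getLast? ≠ some Letter.x) :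
    PowerSeries.coeff 0 (letterSeries a * polylogRev u) = 0 := by
  cases a with
  | y => rw [letterSeries, mul_assoc, PowerSeries.coeff_zero_X_mul]
  | x =>
    cases u with
    | nil => simp at h
    | cons b u => rw [letterSeries, one_mul, polylogRev, coeff_zero_integ]

/-- Multiple polylogarithms as a linear map on `𝔥`. -/
noncomputable def polylog : H →ₗ[ℚ] ℝ⟦X⟧ :=
  (FreeAlgebra.basisFreeMonoid ℚ Letter).constr ℚ fun u => polylogRev u.toList.reverse

theorem polylog_mono (u : List Letter) : polylog (mono u.reverse) = polylogRev u := by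
  rw [polylog, constr_mono, FreeMonoid.toList_ofList, List.reverse_reverse]

theorem polylog_mul_letter (w : H) (a : Letter) :
    polylog (w * FreeAlgebra.ι ℚ a) = integ a (polylog w) := by
  induction w using H_induction with
  | hmono u => rw [← mono_reverse_cons, polylog_mono, polylog_mono, polylogRev]
  | hadd u v hu hv => rw [add_mul, map_add, hu, hv, map_add, integ_add]
  | hsmul c u hu => rw [smul_mul_assoc, map_smul, hu, map_smul, integ_smul]

/-- The shuffle recursion is the Leibniz rule: `theta` of a product removes the last letter of one
factor or of the other. By induction both sides have the same image under `theta`, and both have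
constant term 0. -/
theorem polylog_shuffleRev (u v : List Letter) (hu : u.getLast? ≠ some Letter.x)
    (hv : v.getLast? ≠ some Letter.x) :
    polylog (shuffleRev u v) = polylogRev u * polylogRev v := by
  have tail : ∀ (a : Letter) (u : List Letter), (a :: u).getLast? ≠ some Letter.x →
      u.getLast? ≠ some Letter.x := by
    intro a u hu
    cases u with
    | nil => simp
    | cons b u => rwa [List.getLast?_cons_cons] at hu
  induction u, v using shuffleRev.induct with
  | case1 v => rw [shuffleRev, polylog_mono, polylogRev, one_mul]
  | case2 a u => rw [shuffleRev, polylog_mono, polylogRev, polylogRev, mul_one]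
  | case3 a u b v ih1 ih2 =>
    have ih1 := ih1 (tail a u hu) hv
    have ih2 := ih2 hu (tail b v hv)
    rw [shuffleRev, map_add, polylog_mul_letter, polylog_mul_letter, ih1, ih2]
    have hc : ∀ (a : Letter) (u : List Letter), PowerSeries.coeff 0 (polylogRev (a :: u)) = 0 :=
      fun a u => coeff_zero_integ a _
    apply eq_of_theta_eq
    · rw [map_add, coeff_zero_integ, coeff_zero_integ, coeff_zero_mul, hc]
      simp
    · have hadd : ∀ f g : ℝ⟦X⟧, theta (f + g) = theta f + theta g := fun f g => by
        ext n; simp [theta, mul_add]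
      have ha : theta (polylogRev (a :: u)) = letterSeries a * polylogRev u :=
        theta_integ _ _ (coeff_zero_letterSeries_mul_polylogRev a u hu)
      have hb : theta (polylogRev (b :: v)) = letterSeries b * polylogRev v :=
        theta_integ _ _ (coeff_zero_letterSeries_mul_polylogRev b v hv)
      rw [hadd, theta_mul, ha, hb, theta_integ, theta_integ]
      · ring
      · rw [mul_left_comm, coeff_zero_mul, hc, zero_mul]
      · rw [← mul_assoc, coeff_zero_mul, hc, mul_zero]

theorem polylog_shuffleH1 (u v : H1) :
    polylog (shuffleH1 u v : H1) = polylog (u : H) * polylog (v : H) := by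
  change polylog (shuffle (u : H) (v : H)) = _
  induction u using H1_induction with
  | hz r =>
    induction v using H1_induction with
    | hz t =>
      rw [coe_z, coe_z, shuffle_mono, polylog_shuffleRev _ _ (wordOf_head _) (wordOf_head _),
        ← polylog_mono, ← polylog_mono, List.reverse_reverse, List.reverse_reverse]
    | hadd u v hu hv => simp only [Subalgebra.coe_add, map_add, hu, hv, mul_add]
    | hsmul c u hu => simp only [Subalgebra.coe_smul, map_smul, hu, mul_smul_comm]
  | hadd u v hu hv =>
    simp only [Subalgebra.coe_add, map_add, LinearMap.add_apply, hu, hv, add_mul]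
  | hsmul c u hu =>
    simp only [Subalgebra.coe_smul, map_smul, LinearMap.smul_apply, hu, smul_mul_assoc]

theorem coeff_zero_polylog_mul_zOne (w : H1) (a : ℕ+) :
    PowerSeries.coeff 0 (polylog ((w * zOne a : H1) : H)) = 0 := by
  obtain ⟨v, c, h⟩ : ∃ (v : H) (c : Letter), ((w * zOne a : H1) : H) = v * FreeAlgebra.ι ℚ c := by
    rw [MulMemClass.coe_mul]
    change ∃ v c, (w : H) * (Y * X ^ ((a : ℕ) - 1)) = _
    cases (a : ℕ) - 1 with
    | zero => exact ⟨w, Letter.y, by simp [Y]⟩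
    | succ n => exact ⟨w * (Y * X ^ n), Letter.x, by simp [X, pow_succ, mul_assoc]⟩
  rw [h, polylog_mul_letter, coeff_zero_integ]

/-- The letter y replaces coefficients by partial sums and divides by n + 1; each following x
divides by n + 1 once more. -/
theorem coeff_succ_polylog_mul_zOne (w : H1) (a : ℕ+) (n : ℕ) :
    PowerSeries.coeff (n + 1) (polylog ((w * zOne a : H1) : H)) =
      (∑ i ∈ Finset.range (n + 1), PowerSeries.coeff i (polylog (w : H))) /
        ((n : ℝ) + 1) ^ (a : ℕ) := by
  have key : ∀ m : ℕ, PowerSeries.coeff (n + 1) (polylog ((w : H) * (Y * X ^ m))) =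
      (∑ i ∈ Finset.range (n + 1), PowerSeries.coeff i (polylog (w : H))) /
        ((n : ℝ) + 1) ^ (m + 1) := by
    intro m
    induction m with
    | zero => rw [pow_zero, mul_one, Y, polylog_mul_letter, coeff_succ_integ_y, zero_add, pow_one]
    | succ m ih =>
      rw [pow_succ, ← mul_assoc, ← mul_assoc, X, polylog_mul_letter, coeff_integ_x, mul_assoc,
        ← X, ih, div_div]
      push_cast
      rw [← pow_succ]
  have := key ((a : ℕ) - 1)
  rwa [Nat.sub_add_cancel a.pos] at this

/-- The coefficients of a multiple polylogarithm are the increments of the truncated values. -/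
theorem sum_coeff_polylog (w : H1) (n : ℕ) :
    ∑ i ∈ Finset.range (n + 1), PowerSeries.coeff i (polylog (w : H)) = trunc n w := by
  induction w using H1_induction with
  | hz r =>
    induction r generalizing n with
    | nil =>
      rw [coe_z]
      change ∑ i ∈ Finset.range (n + 1), PowerSeries.coeff i (polylog (mono ([] : List _).reverse))
        = _
      rw [polylog_mono, trunc_z, polylogRev, hsum_nil, Finset.sum_range_succ']
      simp [PowerSeries.coeff_one]
    | cons a r ih =>
      rw [z_reverse_cons, ← z_reverse_cons, trunc_z, z_reverse_cons, hsum, Finset.sum_range_succ',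
        coeff_zero_polylog_mul_zOne, add_zero]
      refine Finset.sum_congr rfl fun m _ => ?_
      rw [coeff_succ_polylog_mul_zOne, ih, trunc_z]
  | hadd u v hu hv => simp only [Subalgebra.coe_add, map_add, Finset.sum_add_distrib, hu, hv]
  | hsmul c u hu =>
    simp only [Subalgebra.coe_smul, map_smul, ← hu, Finset.smul_sum]
    simp

theorem coeff_succ_polylog_z (a : ℕ+) (r : List ℕ+) (n : ℕ) :
    PowerSeries.coeff (n + 1) (polylog ((z (a :: r).reverse : H1) : H)) =
      hsum r n / ((n : ℝ) + 1) ^ (a : ℕ) := by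
  rw [z_reverse_cons, coeff_succ_polylog_mul_zOne, sum_coeff_polylog, trunc_z]


/-! ### Multiple zeta values as limits of truncated ones -/

/-- A strictly increasing tuple of positive integers is determined by its last entry and by the
tuple of the other entries. -/
def tupleEquiv (r : ℕ) (A : ℕ → Prop) :
    {n : Fin (r + 1) → ℕ // ((∀ i, 0 < n i) ∧ StrictMono n) ∧ A (n (Fin.last r) - 1)} ≃
      Σ m : {m // A m}, {n : Fin r → ℕ // ((∀ i, 0 < n i) ∧ StrictMono n) ∧ ∀ i, n i ≤ m.1} where
  toFun n := ⟨⟨n.1 (Fin.last r) - 1, n.2.2⟩, ⟨fun i => n.1 i.castSucc,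
    ⟨⟨fun i => n.2.1.1 _, fun i j h => n.2.1.2 (Fin.castSucc_lt_castSucc_iff.2 h)⟩,
      fun i => Nat.le_sub_one_of_lt (n.2.1.2 (Fin.castSucc_lt_last i))⟩⟩⟩
  invFun p := ⟨Fin.snoc p.2.1 (p.1.1 + 1), by
    refine ⟨⟨fun i => ?_, fun i j h => ?_⟩, ?_⟩
    · induction i using Fin.lastCases with
      | last => rw [Fin.snoc_last]; omega
      | cast i => rw [Fin.snoc_castSucc]; exact p.2.2.1.1 i
    · induction i using Fin.lastCases with
      | last => exact absurd (Fin.le_last j) (not_le.2 h)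
      | cast i =>
        induction j using Fin.lastCases with
        | last => rw [Fin.snoc_last, Fin.snoc_castSucc]; exact Nat.lt_succ_of_le (p.2.2.2 i)
        | cast j =>
          rw [Fin.snoc_castSucc, Fin.snoc_castSucc]
          exact p.2.2.1.2 (Fin.castSucc_lt_castSucc_iff.1 h)
    · rw [Fin.snoc_last]; exact p.1.2⟩
  left_inv n := by
    apply Subtype.ext
    funext i
    induction i using Fin.lastCases with
    | last =>
      have := n.2.1.1 (Fin.last r)
      simp only [Fin.snoc_last]
      omega
    | cast i => simp only [Fin.snoc_castSucc]
  right_inv p := by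
    have ext : ∀ p q : Σ m : {m // A m},
        {n : Fin r → ℕ // ((∀ i, 0 < n i) ∧ StrictMono n) ∧ ∀ i, n i ≤ m.1},
        p.1.1 = q.1.1 → p.2.1 = q.2.1 → p = q := by
      rintro ⟨⟨m, hm⟩, ⟨n, hn⟩⟩ ⟨⟨m', hm'⟩, ⟨n', hn'⟩⟩ h1 h2
      simp only at h1 h2
      subst h1 h2
      rfl
    refine ext _ _ ?_ ?_
    · simp only [Fin.snoc_last, Nat.add_sub_cancel]
    · simp only [Fin.snoc_castSucc]

/-- The terms are nonnegative, so they may be summed fibrewise over the last entry. The predicate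
`A` serves both the finite sums, with `A` the condition `· < N`, and the full series, with `A`
always true. -/
theorem hasSum_tuple_succ {r : ℕ} (e : Fin (r + 1) → ℕ+) (A : ℕ → Prop) (g : ℕ → ℝ) (S : ℝ)
    (hg : ∀ m, HasSum (fun n : {n : Fin r → ℕ // ((∀ i, 0 < n i) ∧ StrictMono n) ∧
      ∀ i, n i ≤ m} => ∏ i, 1 / (n.1 i : ℝ) ^ (e i.castSucc : ℕ)) (g m))
    (hS : HasSum (fun m : {m // A m} => g m.1 / ((m.1 : ℝ) + 1) ^ (e (Fin.last r) : ℕ)) S) :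
    HasSum (fun n : {n : Fin (r + 1) → ℕ // ((∀ i, 0 < n i) ∧ StrictMono n) ∧
      A (n (Fin.last r) - 1)} => ∏ i, 1 / (n.1 i : ℝ) ^ (e i : ℕ)) S := by
  rw [← (tupleEquiv r A).symm.hasSum_iff]
  have hfib : ∀ m : {m // A m}, HasSum (fun n : {n : Fin r → ℕ // ((∀ i, 0 < n i) ∧
      StrictMono n) ∧ ∀ i, n i ≤ m.1} =>
      ((fun n : {n : Fin (r + 1) → ℕ // ((∀ i, 0 < n i) ∧ StrictMono n) ∧
        A (n (Fin.last r) - 1)} => ∏ i, 1 / (n.1 i : ℝ) ^ (e i : ℕ)) ∘ (tupleEquiv r A).symm)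
        ⟨m, n⟩) (g m.1 / ((m.1 : ℝ) + 1) ^ (e (Fin.last r) : ℕ)) := by
    intro m
    have := (hg m.1).mul_right (1 / ((m.1 : ℝ) + 1) ^ (e (Fin.last r) : ℕ))
    rw [mul_one_div] at this
    refine this.congr_fun ?_
    intro n
    simp only [Function.comp_apply, Fin.prod_univ_castSucc, tupleEquiv, Equiv.coe_fn_symm_mk,
      Fin.snoc_castSucc, Fin.snoc_last]
    push_cast
    rfl
  refine hS.sigma_of_hasSum hfib ((summable_sigma_of_nonneg ?_).2 ⟨fun m => (hfib m).summable, ?_⟩)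
  · intro p
    exact Finset.prod_nonneg fun i _ => by positivity
  · exact hS.summable.congr fun m => (hfib m).tsum_eq.symm

theorem reverse_ofFn_succ {r : ℕ} (e : Fin (r + 1) → ℕ+) :
    (List.ofFn e).reverse = e (Fin.last r) :: (List.ofFn fun i => e i.castSucc).reverse := by
  rw [List.ofFn_succ']
  simp

theorem hasSum_hsum {r : ℕ} (e : Fin r → ℕ+) (N : ℕ) :
    HasSum (fun n : {n : Fin r → ℕ // ((∀ i, 0 < n i) ∧ StrictMono n) ∧ ∀ i, n i ≤ N} =>
      ∏ i, 1 / (n.1 i : ℝ) ^ (e i : ℕ)) (hsum (List.ofFn e).reverse N) := by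
  induction r generalizing N with
  | zero =>
    have : Unique {n : Fin 0 → ℕ // ((∀ i, 0 < n i) ∧ StrictMono n) ∧ ∀ i, n i ≤ N} :=
      { default := ⟨Fin.elim0, ⟨fun i => i.elim0, fun i => i.elim0⟩, fun i => i.elim0⟩
        uniq := fun n => Subtype.ext (Subsingleton.elim _ _) }
    simpa only [hsum, Finset.univ_eq_empty, Finset.prod_empty, List.ofFn_zero, List.reverse_nil]
      using hasSum_unique
      (fun n : {n : Fin 0 → ℕ // ((∀ i, 0 < n i) ∧ StrictMono n) ∧ ∀ i, n i ≤ N} =>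
        ∏ i, 1 / (n.1 i : ℝ) ^ (e i : ℕ))
  | succ r ih =>
    rw [reverse_ofFn_succ, hsum]
    set g : ℕ → ℝ := fun m => hsum (List.ofFn fun i => e i.castSucc).reverse m /
      ((m : ℝ) + 1) ^ (e (Fin.last r) : ℕ)
    have hfin : HasSum (fun m : {m // m < N} => g m.1) (∑ m ∈ Finset.range N, g m) :=
      (Equiv.subtypeEquivRight fun m => Finset.mem_range.symm).hasSum_iff.2
        (Finset.hasSum (Finset.range N) g)
    have h := hasSum_tuple_succ e (· < N) _ _ (fun m => ih (fun i => e i.castSucc) m) hfin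
    refine ((Equiv.subtypeEquivRight fun n => ?_).hasSum_iff (f := fun n : {n : Fin (r + 1) → ℕ //
      ((∀ i, 0 < n i) ∧ StrictMono n) ∧ n (Fin.last r) - 1 < N} =>
        ∏ i, 1 / (n.1 i : ℝ) ^ (e i : ℕ))).2 h
    refine and_congr_right fun hn => ⟨fun h => ?_, fun h i => ?_⟩
    · have := h (Fin.last r)
      have := hn.1 (Fin.last r)
      omega
    · have h1 := hn.2.monotone (Fin.le_last i)
      have := hn.1 (Fin.last r)
      omega

theorem mzv_nil : mzv [] = 1 := by
  have : Unique {n : Fin ([] : Index).length → ℕ // (∀ i, 0 < n i) ∧ StrictMono n} :=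
    { default := ⟨Fin.elim0, fun i => i.elim0, fun i => i.elim0⟩
      uniq := fun n => Subtype.ext (funext fun i => i.elim0) }
  rw [mzv, (hasSum_unique _).tsum_eq]
  rfl

theorem mzv_of_hasSum {k : Index} {a : ℕ+} {r : List ℕ+} (hk : k.reverse = a :: r) {S : ℝ}
    (hS : HasSum (fun m : ℕ => hsum r m / ((m : ℝ) + 1) ^ (a : ℕ)) S) : mzv k = S := by
  -- Replacing the index by a tuple of free length l allows a case split on l.
  suffices h : ∀ (l : ℕ) (e : Fin l → ℕ+), (List.ofFn e).reverse = a :: r →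
      HasSum (fun n : {n : Fin l → ℕ // (∀ i, 0 < n i) ∧ StrictMono n} =>
        ∏ i, 1 / (n.1 i : ℝ) ^ (e i : ℕ)) S from
    (h _ k.get (by rw [List.ofFn_get, hk])).tsum_eq
  intro l e he
  cases l with
  | zero => simp at he
  | succ l =>
    rw [reverse_ofFn_succ, List.cons.injEq] at he
    obtain ⟨rfl, rfl⟩ := he
    have h := hasSum_tuple_succ e (fun _ => True) _ S
      (fun m => hasSum_hsum (fun i => e i.castSucc) m)
      ((Equiv.Set.univ ℕ).hasSum_iff.2 hS)
    exact ((Equiv.subtypeEquivRight fun n => (iff_of_eq (and_true _)).symm).hasSum_iff (f := fun n :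
      {n : Fin (l + 1) → ℕ // ((∀ i, 0 < n i) ∧ StrictMono n) ∧ True} =>
        ∏ i, 1 / (n.1 i : ℝ) ^ (e i : ℕ))).2 h

/-! ### Growth of truncated values -/

theorem hsum_one (N : ℕ) : hsum [1] N = (_root_.harmonic N : ℚ) := by
  rw [hsum, _root_.harmonic]
  push_cast
  exact Finset.sum_congr rfl fun m _ => by simp [hsum]

theorem hsum_monotone (r : List ℕ+) : Monotone (hsum r) := by
  cases r with
  | nil => exact monotone_const
  | cons a r =>
    refine monotone_nat_of_le_succ fun n => ?_
    rw [hsum_cons_succ]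
    exact le_add_of_nonneg_right (div_nonneg (hsum_nonneg r n) (by positivity))

/-- Each inner sum is at most its value at the outer bound N, and every exponent is at least 1, so
each nesting costs at most one factor of the harmonic number. -/
theorem hsum_le_pow (r : List ℕ+) (N : ℕ) : hsum r N ≤ hsum [1] N ^ r.length := by
  induction r with
  | nil => simp [hsum]
  | cons a r ih =>
    rw [List.length_cons, pow_succ]
    refine le_trans ?_ (mul_le_mul_of_nonneg_right ih (hsum_nonneg _ _))
    rw [hsum, hsum, Finset.mul_sum]
    refine Finset.sum_le_sum fun m hm => ?_
    rw [hsum_nil, mul_one_div, PNat.one_coe, pow_one]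
    refine div_le_div₀ (hsum_nonneg _ _)
      (hsum_monotone r (Finset.mem_range.1 hm).le) (by positivity) ?_
    exact le_self_pow₀ (by linarith [(Nat.cast_nonneg m : (0 : ℝ) ≤ m)]) a.pos.ne'

/-- Any small exponent would do. With 1/4 one has 1/4 - 2 + 1/2 < -1 in `summable_hsum_div_mul_sqrt`
and 1/4 - 1/2 < 0 in `negligible_of_abs_le`. -/
theorem exists_hsum_one_pow_le (d : ℕ) :
    ∃ C : ℝ, ∀ N : ℕ, hsum [1] N ^ d ≤ C * ((N : ℝ) + 1) ^ (1 / 4 : ℝ) := by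
  -- Chosen so that d ε ≤ 1/4; the summand 1 covers d = 0.
  set ε : ℝ := 1 / (4 * (d + 1)) with hε
  have hε0 : 0 < ε := by positivity
  refine ⟨(1 + 1 / ε) ^ d, fun N => ?_⟩
  have h1 : hsum [1] N ≤ (1 + 1 / ε) * ((N : ℝ) + 1) ^ ε := by
    rw [hsum_one]
    have hN : (1 : ℝ) ≤ (N : ℝ) + 1 := by linarith [(Nat.cast_nonneg N : (0 : ℝ) ≤ N)]
    have h2 := harmonic_le_one_add_log N
    have h3 : Real.log N ≤ Real.log (N + 1) := by
      rcases Nat.eq_zero_or_pos N with rfl | h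
      · simp
      · exact Real.log_le_log (by positivity) (by linarith)
    have h4 := Real.log_le_rpow_div (by positivity : (0 : ℝ) ≤ (N : ℝ) + 1) hε0
    have h5 : (1 : ℝ) ≤ ((N : ℝ) + 1) ^ ε := Real.one_le_rpow hN hε0.le
    have : (1 + 1 / ε) * ((N : ℝ) + 1) ^ ε = ((N : ℝ) + 1) ^ ε + ((N : ℝ) + 1) ^ ε / ε := by ring
    linarith
  refine (pow_le_pow_left₀ (hsum_nonneg _ _) h1 d).trans ?_
  rw [mul_pow]
  refine mul_le_mul_of_nonneg_left ?_ (by positivity)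
  rw [← Real.rpow_natCast, ← Real.rpow_mul (by positivity)]
  refine Real.rpow_le_rpow_of_exponent_le
    (by linarith [(Nat.cast_nonneg N : (0 : ℝ) ≤ N)]) ?_
  rw [hε, div_mul_eq_mul_div, div_le_div_iff₀ (by positivity) (by positivity)]
  linarith

theorem exists_hsum_le (r : List ℕ+) :
    ∃ C : ℝ, ∀ N : ℕ, hsum r N ≤ C * ((N : ℝ) + 1) ^ (1 / 4 : ℝ) := by
  obtain ⟨C, hC⟩ := exists_hsum_one_pow_le r.length
  exact ⟨C, fun N => (hsum_le_pow r N).trans (hC N)⟩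

/-- Convergence even with the extra factor √(m + 1) is what yields the rate O(N^(-1/2)) in
`hasSum_weight_bound`. -/
theorem summable_hsum_div_mul_sqrt {a : ℕ+} (ha : a ≠ 1) (r : List ℕ+) :
    Summable fun m : ℕ => hsum r m / ((m : ℝ) + 1) ^ (a : ℕ) * √((m : ℝ) + 1) := by
  obtain ⟨C, hC⟩ := exists_hsum_le r
  have hs : Summable fun m : ℕ => C * ((m : ℝ) + 1) ^ (-(5 / 4) : ℝ) := by
    refine Summable.mul_left C ?_
    have := (summable_nat_add_iff 1).2 (Real.summable_nat_rpow.2 (by norm_num : -(5 / 4 : ℝ) < -1))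
    simpa using this
  refine Summable.of_nonneg_of_le (fun m => ?_) (fun m => ?_) hs
  · exact mul_nonneg (div_nonneg (hsum_nonneg _ _) (by positivity)) (Real.sqrt_nonneg _)
  · have hm : (1 : ℝ) ≤ (m : ℝ) + 1 := by linarith [(Nat.cast_nonneg m : (0 : ℝ) ≤ m)]
    have h2 : 2 ≤ (a : ℕ) := by
      have := a.pos
      have := mt PNat.coe_eq_one_iff.1 ha
      omega
    have h3 : hsum r m / ((m : ℝ) + 1) ^ (a : ℕ) ≤
        C * ((m : ℝ) + 1) ^ (1 / 4 : ℝ) / ((m : ℝ) + 1) ^ 2 :=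
      div_le_div₀ ((hsum_nonneg _ _).trans (hC m)) (hC m) (by positivity)
        (pow_le_pow_right₀ hm h2)
    refine (mul_le_mul_of_nonneg_right h3 (Real.sqrt_nonneg _)).trans (le_of_eq ?_)
    have hp : (0 : ℝ) < (m : ℝ) + 1 := by positivity
    rw [Real.sqrt_eq_rpow, ← Real.rpow_natCast, mul_div_assoc, mul_assoc, ← Real.rpow_sub hp,
      ← Real.rpow_add hp]
    norm_num

theorem hasSum_mzv {a : ℕ+} (ha : a ≠ 1) (r : List ℕ+) :
    HasSum (fun m : ℕ => hsum r m / ((m : ℝ) + 1) ^ (a : ℕ)) (mzv (a :: r).reverse) := by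
  have hs : Summable (fun m : ℕ => hsum r m / ((m : ℝ) + 1) ^ (a : ℕ)) := by
    refine Summable.of_nonneg_of_le (fun m => ?_) (fun m => ?_) (summable_hsum_div_mul_sqrt ha r)
    · exact div_nonneg (hsum_nonneg _ _) (by positivity)
    · refine le_mul_of_one_le_right (div_nonneg (hsum_nonneg _ _) (by positivity)) ?_
      rw [Real.one_le_sqrt]
      linarith [(Nat.cast_nonneg m : (0 : ℝ) ≤ m)]
  rw [mzv_of_hasSum (List.reverse_reverse _) hs.hasSum]
  exact hs.hasSum

/-- A series `∑ c m (1 - w m)` whose weights satisfy `0 ≤ 1 - w m ≤ √((m + 1) / (N + 1))` is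
`O((N + 1)^(-1/2))`. -/
theorem hasSum_weight_bound {c : ℕ → ℝ} (hc : ∀ m, 0 ≤ c m)
    (hs : Summable fun m : ℕ => c m * √((m : ℝ) + 1)) {S T : ℝ} {w : ℕ → ℝ} {N : ℕ}
    (hS : HasSum c S) (hT : HasSum (fun m => c m * w m) T) (h1 : ∀ m, w m ≤ 1)
    (h2 : ∀ m, 1 - w m ≤ √((m : ℝ) + 1) / √((N : ℝ) + 1)) :
    |T - S| ≤ (∑' m, c m * √((m : ℝ) + 1)) / √((N : ℝ) + 1) := by
  have h := hS.sub hT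
  have h0 : 0 ≤ S - T := h.nonneg fun m => by nlinarith [hc m, h1 m]
  rw [abs_sub_comm, abs_of_nonneg h0]
  refine hasSum_le (fun m => ?_) h (hs.hasSum.div_const _)
  have := mul_le_mul_of_nonneg_left (h2 m) (hc m)
  rw [mul_div_assoc]
  linarith


open Filter Topology

/-! ### Regularization by asymptotic expansion -/

/-- `f` tends to zero faster than every power of `ℓ` grows. -/
def Negligible (ℓ f : ℕ → ℝ) : Prop := ∀ i : ℕ, Tendsto (fun m => f m * ℓ m ^ i) atTop (𝓝 0)

namespace Negligible

variable {ℓ f g : ℕ → ℝ}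

theorem add (hf : Negligible ℓ f) (hg : Negligible ℓ g) :
    Negligible ℓ fun m => f m + g m := fun i => by
  simpa [add_mul] using (hf i).add (hg i)

theorem const_mul (c : ℝ) (hf : Negligible ℓ f) : Negligible ℓ fun m => c * f m := fun i => by
  simpa [mul_assoc] using (hf i).const_mul c

theorem tendsto (hf : Negligible ℓ f) : Tendsto f atTop (𝓝 0) := by simpa using hf 0

theorem mul (hf : Negligible ℓ f) (hg : Negligible ℓ g) :
    Negligible ℓ fun m => f m * g m := fun i => by
  simpa [mul_assoc, mul_comm, mul_left_comm] using (hf i).mul hg.tendsto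

theorem mul_pow (hf : Negligible ℓ f) (j : ℕ) : Negligible ℓ fun m => f m * ℓ m ^ j :=
  fun i => by simpa [mul_assoc, pow_add] using hf (j + i)

theorem mul_aeval (hf : Negligible ℓ f) (P : mzvAlg[X]) :
    Negligible ℓ fun m => f m * Polynomial.aeval (ℓ m) P := by
  induction P using Polynomial.induction_on' with
  | add p q hp hq =>
    simp only [map_add, mul_add]
    exact hp.add hq
  | monomial n a =>
    simp only [Polynomial.aeval_monomial]
    convert (hf.mul_pow n).const_mul (algebraMap mzvAlg ℝ a) using 2 with m
    ring

theorem zero : Negligible ℓ fun _ => 0 := fun i => by simp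

end Negligible

/-- A nonconstant real polynomial is unbounded along ℓ → ∞, and a constant one equals its limit.
This makes asymptotic polynomials unique. -/
theorem eq_zero_of_tendsto_aeval {ℓ : ℕ → ℝ} (hℓ : Tendsto ℓ atTop atTop) {P : mzvAlg[X]}
    (h : Tendsto (fun m => Polynomial.aeval (ℓ m) P) atTop (𝓝 0)) : P = 0 := by
  have hinj : Function.Injective (algebraMap mzvAlg ℝ) := Subtype.val_injective
  set Q : ℝ[X] := P.map (algebraMap mzvAlg ℝ) with hQ
  have hev : ∀ x : ℝ, Polynomial.aeval x P = Q.eval x := fun x => by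
    rw [hQ, Polynomial.eval_map_algebraMap]
  simp only [hev] at h
  have hdeg : Q.degree ≤ 0 := by
    by_contra! hlt
    have h1 := (Q.abs_tendsto_atTop hlt).comp hℓ
    exact not_tendsto_nhds_of_tendsto_atTop h1 _ h.abs
  have hC := Polynomial.eq_C_of_degree_le_zero hdeg
  rw [hC] at h
  simp only [Polynomial.eval_C] at h
  have h0 := tendsto_nhds_unique h tendsto_const_nhds
  rw [← h0, Polynomial.C_0] at hC
  exact (Polynomial.map_eq_zero_iff hinj).1 hC

/-- A realization of the product `•` by linear functionals that are multiplicative, whose values at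
admissible monomials converge to multiple zeta values, and that diverge at `y`. -/
structure IsModel (s : Kind) (Φ : ℕ → H1 →ₗ[ℚ] ℝ) (ℓ : ℕ → ℝ) : Prop where
  tendsto : Tendsto ℓ atTop atTop
  map_one : ∀ m, Φ m 1 = 1
  map_prod : ∀ m u v, Φ m (s.prod u v) = Φ m u * Φ m v
  map_y : ∀ m, Φ m (z [1]) = ℓ m
  admissible : ∀ k, Admissible k → Negligible ℓ fun m => Φ m (z k) - mzv k

namespace IsModel

variable {s : Kind} {Φ : ℕ → H1 →ₗ[ℚ] ℝ} {ℓ : ℕ → ℝ}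

theorem eq_of_negligible (h : IsModel s Φ ℓ) {w : H1} {P Q : mzvAlg[X]}
    (hP : Tendsto (fun m => Φ m w - Polynomial.aeval (ℓ m) P) atTop (𝓝 0))
    (hQ : Tendsto (fun m => Φ m w - Polynomial.aeval (ℓ m) Q) atTop (𝓝 0)) : P = Q := by
  rw [← sub_eq_zero]
  refine eq_zero_of_tendsto_aeval h.tendsto ?_
  simpa using hQ.sub hP

theorem negligible_add {u v : H1} {P Q : mzvAlg[X]}
    (hu : Negligible ℓ fun m => Φ m u - Polynomial.aeval (ℓ m) P)
    (hv : Negligible ℓ fun m => Φ m v - Polynomial.aeval (ℓ m) Q) :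
    Negligible ℓ fun m => Φ m (u + v) - Polynomial.aeval (ℓ m) (P + Q) := by
  have := hu.add hv
  simpa only [map_add, add_sub_add_comm] using this

theorem negligible_smul (c : ℚ) {u : H1} {P : mzvAlg[X]}
    (hu : Negligible ℓ fun m => Φ m u - Polynomial.aeval (ℓ m) P) :
    Negligible ℓ fun m => Φ m (c • u) - Polynomial.aeval (ℓ m) (c • P) := by
  have := hu.const_mul c
  have e : ∀ m, Polynomial.aeval (ℓ m) (c • P) = c • Polynomial.aeval (ℓ m) P := fun m =>
    map_rat_smul (Polynomial.aeval (R := mzvAlg) (ℓ m)) c P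
  simpa only [map_smul, e, Rat.smul_def, mul_sub] using this

theorem negligible_prod (h : IsModel s Φ ℓ) {u v : H1} {P Q : mzvAlg[X]}
    (hu : Negligible ℓ fun m => Φ m u - Polynomial.aeval (ℓ m) P)
    (hv : Negligible ℓ fun m => Φ m v - Polynomial.aeval (ℓ m) Q) :
    Negligible ℓ fun m => Φ m (s.prod u v) - Polynomial.aeval (ℓ m) (P * Q) := by
  -- Writing U, V for the two values, UV - PQ = (U - P)(V - Q) + (U - P)Q + (V - Q)P. The last two
  -- terms are the reason for requiring decay against all powers of ℓ.
  have h3 := ((hu.mul hv).add (hu.mul_aeval Q)).add (hv.mul_aeval P)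
  convert h3 using 2 with m
  rw [h.map_prod, map_mul]
  ring

theorem negligible_y (h : IsModel s Φ ℓ) :
    Negligible ℓ fun m => Φ m (z [1]) - Polynomial.aeval (ℓ m) (Polynomial.X : mzvAlg[X]) := by
  convert Negligible.zero (ℓ := ℓ) using 2 with m
  rw [h.map_y, Polynomial.aeval_X, sub_self]

theorem exists_negligible (h : IsModel s Φ ℓ) (w : H1) :
    ∃ P : mzvAlg[X], Negligible ℓ fun m => Φ m w - Polynomial.aeval (ℓ m) P := by
  let V : Submodule ℚ H1 :=
    { carrier := {w | ∃ P : mzvAlg[X], Negligible ℓ fun m => Φ m w - Polynomial.aeval (ℓ m) P}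
      add_mem' := fun ⟨P, hP⟩ ⟨Q, hQ⟩ => ⟨P + Q, negligible_add hP hQ⟩
      zero_mem' := ⟨0, by simpa using Negligible.zero⟩
      smul_mem' := fun c _ ⟨P, hP⟩ => ⟨c • P, negligible_smul c hP⟩ }
  refine mem_of_admissible_of_prod_y s V (fun k hk => ?_) (fun w ⟨P, hP⟩ => ?_) w
  · refine ⟨Polynomial.C (mzvZ k hk), ?_⟩
    simp only [Polynomial.aeval_C]
    exact h.admissible k hk
  · exact ⟨P * Polynomial.X, h.negligible_prod hP h.negligible_y⟩

/-- Since the asymptotic polynomial is unique, every identity required of Z follows from the same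
identity for Φ up to negligible terms. -/
theorem exists_isRegularization (h : IsModel s Φ ℓ) :
    ∃ Z, IsRegularization s Z ∧
      ∀ w, Negligible ℓ fun m => Φ m w - Polynomial.aeval (ℓ m) (Z w) := by
  choose Z hZ using h.exists_negligible
  have key : ∀ {w P}, (Negligible ℓ fun m => Φ m w - Polynomial.aeval (ℓ m) P) → Z w = P :=
    fun hP => h.eq_of_negligible (hZ _).tendsto hP.tendsto
  refine ⟨{ toFun := Z
            map_add' := fun u v => key (negligible_add (hZ u) (hZ v))
            map_smul' := fun c u => key (negligible_smul c (hZ u)) }, ⟨?_, ?_, ?_, ?_⟩, hZ⟩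
  · refine key ?_
    convert Negligible.zero (ℓ := ℓ) using 2 with m
    rw [h.map_one, _root_.map_one, sub_self]
  · exact fun u v => key (h.negligible_prod (hZ u) (hZ v))
  · intro k hk
    refine key ?_
    simp only [Polynomial.aeval_C]
    exact h.admissible k hk
  · exact key h.negligible_y

end IsModel

/-! ### Uniqueness of the regularization and its derivative in T -/

theorem IsRegularization.unique {s : Kind} {Z Z' : H1 →ₗ[ℚ] mzvAlg[X]}
    (h : IsRegularization s Z) (h' : IsRegularization s Z') : Z = Z' := by
  ext1 w
  refine mem_of_admissible_of_prod_y s (LinearMap.eqLocus Z Z') (fun k hk => ?_)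
    (fun u hu => ?_) w
  · change Z _ = Z' _
    rw [h.map_admissible k hk, h'.map_admissible k hk]
  · change Z _ = Z' _
    rw [h.map_prod, h'.map_prod, h.map_y, h'.map_y, show Z u = Z' u from hu]

/-- Both sides vanish on admissible monomials and obey the same Leibniz rule for products with y. -/
theorem IsRegularization.derivative {s : Kind} {Z : H1 →ₗ[ℚ] mzvAlg[X]}
    (h : IsRegularization s Z) (w : H1) : Polynomial.derivative (Z w) = Z (del w) := by
  let D : mzvAlg[X] →ₗ[ℚ] mzvAlg[X] := Polynomial.derivative.restrictScalars ℚ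
  refine mem_of_admissible_of_prod_y s (LinearMap.eqLocus (D ∘ₗ Z) (Z ∘ₗ del)) (fun k hk => ?_)
    (fun u hu => ?_) w
  · change Polynomial.derivative (Z _) = Z (del _)
    have : del (z k) = 0 := by
      rw [← List.reverse_reverse k] at hk ⊢
      rw [del_z]
      cases hr : k.reverse with
      | nil => rfl
      | cons a r =>
        rw [hr, admissible_reverse_cons] at hk
        rw [delRev, if_neg hk]
    rw [h.map_admissible k hk, this, map_zero, Polynomial.derivative_C]
  · have hu : Polynomial.derivative (Z u) = Z (del u) := hu
    change Polynomial.derivative (Z _) = Z (del _)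
    rw [del_prod_y, map_add, h.map_prod, h.map_prod, h.map_y, Polynomial.derivative_mul, hu,
      Polynomial.derivative_X, mul_one]

/-! ### The two models -/

theorem negligible_of_abs_le {ℓ f : ℕ → ℝ} (hℓ0 : ∀ m, 0 ≤ ℓ m) (hℓ : ∀ m, ℓ m ≤ hsum [1] m)
    {C : ℝ} (hf : ∀ m : ℕ, |f m| ≤ C / √((m : ℝ) + 1)) : Negligible ℓ f := by
  intro i
  obtain ⟨D, hD⟩ := exists_hsum_one_pow_le i
  have hlim : Tendsto (fun m : ℕ => |C| * |D| * ((m : ℝ) + 1) ^ (-(1 / 4) : ℝ)) atTop (𝓝 0) := by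
    have := ((tendsto_rpow_neg_atTop (by norm_num : (0 : ℝ) < 1 / 4)).comp
      (tendsto_atTop_add_const_right _ (1 : ℝ) tendsto_natCast_atTop_atTop)).const_mul (|C| * |D|)
    simpa using this
  refine squeeze_zero_norm (fun m => ?_) hlim
  have hp : (0 : ℝ) < (m : ℝ) + 1 := by positivity
  rw [Real.norm_eq_abs, abs_mul, abs_of_nonneg (pow_nonneg (hℓ0 m) i)]
  have h1 : |f m| ≤ |C| * ((m : ℝ) + 1) ^ (-(1 / 2) : ℝ) := by
    refine (hf m).trans ?_
    rw [Real.rpow_neg hp.le, ← Real.sqrt_eq_rpow, div_eq_mul_inv]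
    exact mul_le_mul_of_nonneg_right (le_abs_self C) (by positivity)
  have h2 : ℓ m ^ i ≤ |D| * ((m : ℝ) + 1) ^ (1 / 4 : ℝ) :=
    ((pow_le_pow_left₀ (hℓ0 m) (hℓ m) i).trans (hD m)).trans
      (mul_le_mul_of_nonneg_right (le_abs_self D) (by positivity))
  refine (mul_le_mul h1 h2 (pow_nonneg (hℓ0 m) i) (by positivity)).trans (le_of_eq ?_)
  rw [mul_mul_mul_comm, ← Real.rpow_add hp]
  norm_num

theorem log_le_hsum_one (m : ℕ) : Real.log ((m : ℝ) + 1) ≤ hsum [1] m := by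
  rw [hsum_one]
  exact_mod_cast log_add_one_le_harmonic m

theorem tendsto_log_succ : Tendsto (fun m : ℕ => Real.log ((m : ℝ) + 1)) atTop atTop :=
  Real.tendsto_log_atTop.comp
    (tendsto_atTop_add_const_right _ (1 : ℝ) tendsto_natCast_atTop_atTop)

theorem isModel_trunc : IsModel .harmonic trunc (hsum [1]) where
  tendsto := tendsto_atTop_mono log_le_hsum_one tendsto_log_succ
  map_one := trunc_one
  map_prod := trunc_harmonic
  map_y m := trunc_z m [1]
  admissible k hk := by
    rw [← List.reverse_reverse k] at hk ⊢
    cases hr : k.reverse with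
    | nil =>
      convert Negligible.zero using 2 with m
      rw [trunc_z, List.reverse_nil, mzv_nil, hsum_nil, sub_self]
    | cons a r =>
      rw [hr, admissible_reverse_cons] at hk
      refine negligible_of_abs_le
        (C := ∑' m : ℕ, hsum r m / ((m : ℝ) + 1) ^ (a : ℕ) * √((m : ℝ) + 1))
        (fun m => hsum_nonneg _ m) (fun m => le_rfl) fun N => ?_
      rw [trunc_z]
      -- Truncation is a weight 1 for m < N and 0 otherwise; where it differs from 1, √((m + 1)/(N +
      -- 1)) is at least 1.
      refine hasSum_weight_bound (fun m => div_nonneg (hsum_nonneg r m) (by positivity))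
        (summable_hsum_div_mul_sqrt hk r) (hasSum_mzv hk r)
        (w := fun m => if m < N then 1 else 0) ?_ (fun m => ?_) (fun m => ?_)
      · rw [hsum]
        have := hasSum_sum_of_ne_finset_zero (L := SummationFilter.unconditional ℕ)
          (s := Finset.range N) (f := fun m : ℕ =>
          hsum r m / ((m : ℝ) + 1) ^ (a : ℕ) * if m < N then (1 : ℝ) else 0) (fun m hm => by
            rw [Finset.mem_range] at hm
            simp [hm])
        convert this using 1
        refine Finset.sum_congr rfl fun m hm => ?_
        rw [if_pos (Finset.mem_range.1 hm), mul_one]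
      · split <;> norm_num
      · split
        · rw [sub_self]; positivity
        · rw [sub_zero, le_div_iff₀ (by positivity), one_mul]
          refine Real.sqrt_le_sqrt ?_
          have : (N : ℝ) ≤ m := by exact_mod_cast not_lt.1 ‹_›
          linarith

/-- The point `1 - 1 / (m + 1)`. -/
noncomputable def point (m : ℕ) : ℝ := 1 - 1 / ((m : ℝ) + 1)

theorem point_nonneg (m : ℕ) : 0 ≤ point m := by
  rw [point, sub_nonneg, div_le_one (by positivity)]
  linarith [(Nat.cast_nonneg m : (0 : ℝ) ≤ m)]

theorem point_lt_one (m : ℕ) : point m < 1 := by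
  rw [point]
  have : (0 : ℝ) < 1 / ((m : ℝ) + 1) := by positivity
  linarith

theorem summable_polylog (w : H1) {x : ℝ} (hx0 : 0 ≤ x) (hx1 : x < 1) :
    Summable fun n => PowerSeries.coeff n (polylog (w : H)) * x ^ n := by
  induction w using H1_induction with
  | hz r =>
    cases r with
    | nil =>
      rw [coe_z]
      change Summable fun n => PowerSeries.coeff n (polylog (mono ([] : List _).reverse)) * x ^ n
      rw [polylog_mono, polylogRev]
      refine summable_of_ne_finset_zero (s := {0}) fun n hn => ?_
      rw [PowerSeries.coeff_one, if_neg (by simpa using hn), zero_mul]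
    | cons a r =>
      rw [← summable_nat_add_iff 1]
      obtain ⟨C, hC⟩ := exists_hsum_le r
      have h0 : Summable fun n : ℕ => (n : ℝ) ^ 1 * x ^ n :=
        summable_pow_mul_geometric_of_norm_lt_one 1
          (by rwa [Real.norm_eq_abs, abs_of_nonneg hx0])
      have hg : Summable fun n : ℕ => |C| * (((n : ℝ) + 1) * x ^ (n + 1)) := by
        refine Summable.mul_left _ ?_
        have h1 := (summable_nat_add_iff 1).2 h0
        simpa only [pow_one, Nat.cast_add, Nat.cast_one] using h1
      simp only [coeff_succ_polylog_z]
      refine Summable.of_nonneg_of_le (fun n => ?_) (fun n => ?_) hg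
      · exact mul_nonneg (div_nonneg (hsum_nonneg _ _) (by positivity)) (pow_nonneg hx0 _)
      · rw [← mul_assoc]
        refine mul_le_mul_of_nonneg_right ?_ (pow_nonneg hx0 _)
        have h1 : (1 : ℝ) ≤ (n : ℝ) + 1 := by linarith [(Nat.cast_nonneg n : (0 : ℝ) ≤ n)]
        have h2 := (div_le_self (hsum_nonneg r n) (one_le_pow₀ h1 (n := (a : ℕ)))).trans (hC n)
        have h3 : ((n : ℝ) + 1) ^ (1 / 4 : ℝ) ≤ (n : ℝ) + 1 :=
          (Real.rpow_le_rpow_of_exponent_le h1 (by norm_num : (1 / 4 : ℝ) ≤ 1)).trans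
            (Real.rpow_one _).le
        exact h2.trans (mul_le_mul (le_abs_self C) h3 (by positivity) (abs_nonneg C))
  | hadd u v hu hv => simpa [add_mul] using hu.add hv
  | hsmul c u hu => simpa [Rat.smul_def, mul_assoc] using hu.mul_left (c : ℝ)

/-- The values of multiple polylogarithms at `1 - 1 / (m + 1)` as linear maps on `𝔥¹`. -/
noncomputable def polylogAt (m : ℕ) : H1 →ₗ[ℚ] ℝ where
  toFun w := ∑' n, PowerSeries.coeff n (polylog (w : H)) * point m ^ n
  map_add' u v := by
    rw [← (summable_polylog u (point_nonneg m) (point_lt_one m)).tsum_add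
      (summable_polylog v (point_nonneg m) (point_lt_one m))]
    simp [add_mul]
  map_smul' c u := by
    rw [RingHom.id_apply, Rat.smul_def, ← tsum_mul_left]
    simp [Rat.smul_def, mul_assoc]

theorem hasSum_polylogAt (m : ℕ) (w : H1) :
    HasSum (fun n => PowerSeries.coeff n (polylog (w : H)) * point m ^ n) (polylogAt m w) :=
  (summable_polylog w (point_nonneg m) (point_lt_one m)).hasSum

theorem hasSum_polylogAt_z (m : ℕ) (a : ℕ+) (r : List ℕ+) :
    HasSum (fun n : ℕ => hsum r n / ((n : ℝ) + 1) ^ (a : ℕ) * point m ^ (n + 1))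
      (polylogAt m (z (a :: r).reverse)) := by
  have h := (hasSum_nat_add_iff' 1).2 (hasSum_polylogAt m (z (a :: r).reverse))
  have h0 : PowerSeries.coeff 0 (polylog ((z (a :: r).reverse : H1) : H)) = 0 := by
    rw [z_reverse_cons, coeff_zero_polylog_mul_zOne]
  rw [Finset.sum_range_one, h0, zero_mul, sub_zero] at h
  simpa only [coeff_succ_polylog_z] using h

theorem polylogAt_shuffle (m : ℕ) (u v : H1) :
    polylogAt m (shuffleH1 u v) = polylogAt m u * polylogAt m v := by
  have h := tsum_mul_tsum_eq_tsum_sum_antidiagonal_of_summable_norm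
    (summable_polylog u (point_nonneg m) (point_lt_one m)).norm
    (summable_polylog v (point_nonneg m) (point_lt_one m)).norm
  change ∑' n, _ = (∑' n, _) * ∑' n, _
  rw [h]
  refine tsum_congr fun n => ?_
  rw [polylog_shuffleH1, PowerSeries.coeff_mul, Finset.sum_mul]
  refine Finset.sum_congr rfl fun p hp => ?_
  rw [← Finset.HasAntidiagonal.mem_antidiagonal.1 hp, pow_add]
  ring

theorem polylogAt_one (m : ℕ) : polylogAt m 1 = 1 := by
  have h := hasSum_polylogAt m 1
  have h1 : polylog ((1 : H1) : H) = 1 := by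
    have := polylog_mono []
    simpa [mono, polylogRev] using this
  rw [h1] at h
  refine h.unique ?_
  have := hasSum_single (f := fun n => PowerSeries.coeff n (1 : ℝ⟦X⟧) * point m ^ n) 0
    (fun n hn => by rw [PowerSeries.coeff_one, if_neg hn, zero_mul])
  simpa using this

theorem isModel_polylogAt : IsModel .shuffle polylogAt fun m => Real.log ((m : ℝ) + 1) where
  tendsto := tendsto_log_succ
  map_one := polylogAt_one
  map_prod := polylogAt_shuffle
  map_y m := by
    have h1 := hasSum_polylogAt_z m 1 []
    have h2 := Real.hasSum_pow_div_log_of_abs_lt_one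
      (by rw [abs_of_nonneg (point_nonneg m)]; exact point_lt_one m : |point m| < 1)
    -- The evaluation point is chosen so that the polylogarithm of y is exactly log(m + 1).
    have h3 : -Real.log (1 - point m) = Real.log ((m : ℝ) + 1) := by
      rw [point, sub_sub_cancel, one_div, Real.log_inv, neg_neg]
    rw [h3] at h2
    refine h1.unique (h2.congr_fun fun n => ?_)
    rw [hsum_nil, PNat.one_coe, pow_one]
    ring
  admissible k hk := by
    rw [← List.reverse_reverse k] at hk ⊢
    cases hr : k.reverse with
    | nil =>
      convert Negligible.zero using 2 with m
      rw [List.reverse_nil, mzv_nil, z_nil, polylogAt_one, sub_self]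
    | cons a r =>
      rw [hr, admissible_reverse_cons] at hk
      refine negligible_of_abs_le
        (C := ∑' m : ℕ, hsum r m / ((m : ℝ) + 1) ^ (a : ℕ) * √((m : ℝ) + 1))
        (fun m => Real.log_nonneg (by
        linarith [(Nat.cast_nonneg m : (0 : ℝ) ≤ m)])) log_le_hsum_one fun N => ?_
      refine hasSum_weight_bound (fun m => div_nonneg (hsum_nonneg r m) (by positivity))
        (summable_hsum_div_mul_sqrt hk r) (hasSum_mzv hk r) (hasSum_polylogAt_z N a r)
        (fun m => pow_le_one₀ (point_nonneg N) (point_lt_one N).le) (fun m => ?_)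
      rw [← Real.sqrt_div (by positivity)]
      have hp := pow_nonneg (point_nonneg N) (m + 1)
      -- Bernoulli's inequality.
      have h1 : 1 - point N ^ (m + 1) ≤ ((m : ℝ) + 1) / ((N : ℝ) + 1) := by
        have := one_add_mul_le_pow (a := -(1 / ((N : ℝ) + 1)))
          (by linarith [point_nonneg N, show point N = 1 - 1 / ((N : ℝ) + 1) from rfl]) (m + 1)
        rw [← sub_eq_add_neg] at this
        change _ ≤ point N ^ (m + 1) at this
        push_cast at this
        have e : ((m : ℝ) + 1) * -(1 / ((N : ℝ) + 1)) = -(((m : ℝ) + 1) / ((N : ℝ) + 1)) := by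
          ring
        linarith
      -- A number in [0, 1] is at least its square, so the bound of `h1` also bounds the square.
      refine Real.le_sqrt_of_sq_le ?_
      have h2 : 0 ≤ 1 - point N ^ (m + 1) := by
        linarith [pow_le_one₀ (point_nonneg N) (point_lt_one N).le (n := m + 1)]
      nlinarith


/-! ### Comparison of the two regularizations -/

theorem exists_isRegularization (s : Kind) : ∃ Z, IsRegularization s Z := by
  cases s with
  | harmonic => exact isModel_trunc.exists_isRegularization.imp fun _ h => h.1
  | shuffle => exact isModel_polylogAt.exists_isRegularization.imp fun _ h => h.1

theorem isRegularization_regHom (s : Kind) : IsRegularization s (regHom s) :=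
  Classical.epsilon_spec (exists_isRegularization s)

theorem IsModel.tendsto_sub {s : Kind} {Φ : ℕ → H1 →ₗ[ℚ] ℝ} {ℓ : ℕ → ℝ} (h : IsModel s Φ ℓ)
    (w : H1) : Tendsto (fun m => Φ m w - Polynomial.aeval (ℓ m) (regHom s w)) atTop (𝓝 0) := by
  obtain ⟨Z, hZ, hn⟩ := h.exists_isRegularization
  rw [(isRegularization_regHom s).unique hZ]
  exact (hn w).tendsto

theorem tendsto_point : Tendsto point atTop (𝓝[<] 1) := by
  refine tendsto_nhdsWithin_iff.2 ⟨?_, Eventually.of_forall point_lt_one⟩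
  have := (tendsto_one_div_add_atTop_nhds_zero_nat (𝕜 := ℝ)).const_sub 1
  rwa [sub_zero] at this

/-- Abel's theorem, transporting relations between truncated values to polylogarithms. -/
theorem tendsto_polylogAt_of_trunc (w : H1) (d : ℕ → ℝ) (u : ℕ → H1) (M : ℕ)
    (h : Tendsto (fun N => trunc N w - ∑ j ∈ Finset.range M, d j * trunc N (u j)) atTop (𝓝 0)) :
    Tendsto (fun m => polylogAt m w - ∑ j ∈ Finset.range M, d j * polylogAt m (u j)) atTop
      (𝓝 0) := by
  let f : ℕ → ℝ := fun n => PowerSeries.coeff n (polylog (w : H)) -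
    ∑ j ∈ Finset.range M, d j * PowerSeries.coeff n (polylog (u j : H))
  have hf : Tendsto (fun n => ∑ i ∈ Finset.range n, f i) atTop (𝓝 0) := by
    -- The coefficients of degree at most N, that is N + 1 of them, add up to the truncated value at
    -- N.
    rw [← tendsto_add_atTop_iff_nat 1]
    refine h.congr fun N => ?_
    rw [Finset.sum_sub_distrib, sum_coeff_polylog, Finset.sum_comm]
    simp_rw [← Finset.mul_sum, sum_coeff_polylog]
  refine ((Real.tendsto_tsum_powerSeries_nhdsWithin_lt hf).comp tendsto_point).congr fun m => ?_
  refine HasSum.tsum_eq ?_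
  have h1 := (hasSum_polylogAt m w).sub
    (hasSum_sum (s := Finset.range M) fun j _ => (hasSum_polylogAt m (u j)).mul_left (d j))
  refine h1.congr_fun fun n => ?_
  simp only [f, sub_mul, Finset.sum_mul, mul_assoc]

theorem aeval_C_mul (x : ℝ) (c : mzvAlg) (P : mzvAlg[X]) :
    Polynomial.aeval x (Polynomial.C c * P) = (c : ℝ) * Polynomial.aeval x P := by
  rw [map_mul, Polynomial.aeval_C]
  rfl

/-- The relation says that a combination of truncated values tends to 0. By Abel's theorem so does
the same combination of polylogarithms, whose asymptotic polynomial is then zero. The coefficients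
are free of T, because T stands for different divergent quantities on the two sides. -/
theorem regHom_shuffle_eq_sum (w : H1) (d : ℕ → mzvAlg) (u : ℕ → H1) (M : ℕ)
    (h : regHom .harmonic w =
      ∑ j ∈ Finset.range M, Polynomial.C (d j) * regHom .harmonic (u j)) :
    regHom .shuffle w = ∑ j ∈ Finset.range M, Polynomial.C (d j) * regHom .shuffle (u j) := by
  have hsum : ∀ (s : Kind) (Φ : ℕ → H1 →ₗ[ℚ] ℝ) (ℓ : ℕ → ℝ), IsModel s Φ ℓ →
      Tendsto (fun m => (Φ m w - ∑ j ∈ Finset.range M, (d j : ℝ) * Φ m (u j)) -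
        Polynomial.aeval (ℓ m) (regHom s w -
          ∑ j ∈ Finset.range M, Polynomial.C (d j) * regHom s (u j))) atTop (𝓝 0) := by
    intro s Φ ℓ hm
    have h1 := (hm.tendsto_sub w).sub (tendsto_finsetSum (Finset.range M) fun j _ =>
      (hm.tendsto_sub (u j)).const_mul (d j : ℝ))
    simp only [mul_zero, Finset.sum_const_zero, sub_zero] at h1
    refine h1.congr fun m => ?_
    simp only [map_sub, map_sum, aeval_C_mul, mul_sub, Finset.sum_sub_distrib]
    ring
  have h1 := hsum _ _ _ isModel_trunc
  simp only [h, sub_self, map_zero, sub_zero] at h1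
  have h2 := (tendsto_polylogAt_of_trunc w _ u M h1).sub (hsum _ _ _ isModel_polylogAt)
  simp only [sub_sub_cancel, sub_zero] at h2
  exact sub_eq_zero.1 (eq_zero_of_tendsto_aeval isModel_polylogAt.tendsto h2)

/-- The monomial `yⁿ`. -/
noncomputable def powY (n : ℕ) : H1 := z (List.replicate n 1)

theorem powY_zero : powY 0 = 1 := rfl

theorem powY_eq_reverse (n : ℕ) : powY n = z (List.replicate n (1 : ℕ+)).reverse := by
  rw [List.reverse_replicate]; rfl

theorem powY_succ (n : ℕ) : powY (n + 1) = powY n * zOne 1 := by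
  rw [powY_eq_reverse, List.replicate_succ, z_reverse_cons, ← powY_eq_reverse]

theorem del_powY_succ (n : ℕ) : del (powY (n + 1)) = powY n := by
  rw [powY_succ, del_mul_zOne, if_pos rfl]

theorem coe_powY (n : ℕ) : ((powY n : H1) : H) = mono (List.replicate n Letter.y) := by
  rw [powY, coe_z]
  congr 1
  induction n with
  | zero => rfl
  | succ n ih =>
    rw [List.replicate_succ, List.replicate_succ, ← ih]
    rfl

theorem shuffleRev_replicate_y (n : ℕ) :
    shuffleRev (List.replicate n Letter.y) [Letter.y] =
      (n + 1 : ℚ) • mono (List.replicate (n + 1) Letter.y) := by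
  induction n with
  | zero => simp [shuffleRev]
  | succ n ih =>
    have h : ∀ m : ℕ, mono (List.replicate m Letter.y) * FreeAlgebra.ι ℚ Letter.y =
        mono (List.replicate (m + 1) Letter.y) := fun m => by
      rw [← List.reverse_replicate, ← mono_reverse_cons, ← List.replicate_succ,
        List.reverse_replicate]
    have h2 : shuffleRev (Letter.y :: List.replicate n Letter.y) [] =
        mono (Letter.y :: List.replicate n Letter.y).reverse := by rw [shuffleRev]
    rw [List.replicate_succ, shuffleRev, ih, h2, ← List.replicate_succ, List.reverse_replicate,
      smul_mul_assoc, h]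
    push_cast
    module

theorem shuffleH1_powY (n : ℕ) : shuffleH1 (powY n) (z [1]) = (n + 1 : ℚ) • powY (n + 1) := by
  apply Subtype.ext
  change shuffle ((powY n : H1) : H) ((z [1] : H1) : H) = (n + 1 : ℚ) • ((powY (n + 1) : H1) : H)
  rw [coe_powY, coe_powY, coe_z_one, shuffle_mono, List.reverse_replicate, List.reverse_singleton,
    shuffleRev_replicate_y]

/-- The constant term of the regularized polynomial. -/
noncomputable def regConst (s : Kind) : H1 →ₗ[ℚ] mzvAlg :=
  (Polynomial.leval (0 : mzvAlg)).restrictScalars ℚ ∘ₗ regHom s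

theorem regConst_apply (s : Kind) (w : H1) : regConst s w = (regHom s w).eval 0 := rfl

theorem regConst_z (s : Kind) (k : Index) : regConst s (z k) = zetaReg s k := rfl

theorem regConst_one (s : Kind) : regConst s 1 = 1 := by
  rw [regConst_apply, (isRegularization_regHom s).map_one, Polynomial.eval_one]

theorem regConst_prod (s : Kind) (u v : H1) :
    regConst s (s.prod u v) = regConst s u * regConst s v := by
  simp only [regConst_apply, (isRegularization_regHom s).map_prod, Polynomial.eval_mul]

theorem regConst_y (s : Kind) : regConst s (z [1]) = 0 := by
  rw [regConst_apply, (isRegularization_regHom s).map_y, Polynomial.eval_X]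

/-- Up to a nonzero rational factor, yⁿ⁺¹ is yⁿ ш y, and y has regularized value 0. -/
theorem regConst_shuffle_powY_succ (n : ℕ) : regConst .shuffle (powY (n + 1)) = 0 := by
  have h := regConst_prod .shuffle (powY n) (z [1])
  change regConst .shuffle (shuffleH1 _ _) = _ at h
  rw [shuffleH1_powY, regConst_y, mul_zero, map_smul] at h
  exact (smul_eq_zero.1 h).resolve_left (by positivity)

/-- Induction on the order of nilpotency: differentiating replaces w by `del w`, so the inductive
hypothesis gives the formula up to a constant. -/
theorem regHom_harmonic_eq_sum (w : H1) (m : ℕ) (hm : (del ^ m) w = 0) :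
    regHom .harmonic w = ∑ j ∈ Finset.range m,
      Polynomial.C (regConst .shuffle ((del ^ j) w)) * regHom .harmonic (powY j) := by
  induction m generalizing w with
  | zero =>
    have : w = 0 := hm
    rw [this]; simp
  | succ m ih =>
    have hd := ih (del w) (by rwa [pow_succ, Module.End.mul_apply] at hm)
    simp only [← Module.End.mul_apply, ← pow_succ] at hd
    set S : mzvAlg[X] := ∑ j ∈ Finset.range m,
      Polynomial.C (regConst .shuffle ((del ^ (j + 1)) w)) * regHom .harmonic (powY (j + 1))
      with hS
    have hder : Polynomial.derivative (regHom .harmonic w - S) = 0 := by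
      rw [Polynomial.derivative_sub, (isRegularization_regHom .harmonic).derivative, hd, hS,
        Polynomial.derivative_sum, sub_eq_zero]
      refine Finset.sum_congr rfl fun j _ => ?_
      rw [Polynomial.derivative_C_mul, (isRegularization_regHom .harmonic).derivative,
        del_powY_succ]
    obtain ⟨q, hq⟩ : ∃ q, regHom .harmonic w - S = Polynomial.C q :=
      ⟨_, Polynomial.eq_C_of_derivative_eq_zero hder⟩
    let d : ℕ → mzvAlg := fun j => Nat.casesOn j q fun j => regConst .shuffle ((del ^ (j + 1)) w)
    have h1 : regHom .harmonic w =
        ∑ j ∈ Finset.range (m + 1), Polynomial.C (d j) * regHom .harmonic (powY j) := by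
      rw [Finset.sum_range_succ', powY_zero, (isRegularization_regHom .harmonic).map_one, mul_one]
      change _ = S + Polynomial.C q
      rw [← hq, add_sub_cancel]
    -- On the shuffle side at T = 0 only the term with y⁰ survives, which identifies the constant q
    -- as the shuffle-regularized value of w.
    have h2 := congrArg (Polynomial.eval 0) (regHom_shuffle_eq_sum w d powY (m + 1) h1)
    rw [Polynomial.eval_finsetSum, Finset.sum_range_succ', Finset.sum_eq_zero, zero_add,
      Polynomial.eval_mul, Polynomial.eval_C, ← regConst_apply, ← regConst_apply, powY_zero,
      regConst_one, mul_one] at h2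
    · rw [h1]
      refine Finset.sum_congr rfl fun j _ => ?_
      cases j with
      | zero => rw [pow_zero, Module.End.one_apply, h2]
      | succ j => rfl
    · intro j _
      rw [Polynomial.eval_mul, ← regConst_apply, regConst_shuffle_powY_succ, mul_zero]

/-- `∑ⱼ aⱼ f(r without its first j entries)`, over the `j` for which these entries are all `1`. -/
def conv {R : Type*} [CommSemiring R] : (ℕ → R) → (List ℕ+ → R) → List ℕ+ → R
  | a, f, [] => a 0 * f []
  | a, f, c :: r => a 0 * f (c :: r) + if c = 1 then conv (fun j => a (j + 1)) f r else 0

/-- `ζ^∗(1, …, 1)`, with `j` entries. -/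
noncomputable def regOnes (j : ℕ) : mzvAlg := regConst .harmonic (powY j)

theorem conv_shuffle_eq_sum (a : ℕ → mzvAlg) (r : List ℕ+) :
    conv a (fun r => zetaReg .shuffle r.reverse) r =
      ∑ j ∈ Finset.range (r.length + 1), regConst .shuffle ((del ^ j) (z r.reverse)) * a j := by
  induction r generalizing a with
  | nil => simp [conv, regConst_z, mul_comm]
  | cons c r ih =>
    rw [conv, List.length_cons, Finset.sum_range_succ', ih, add_comm, pow_zero,
      Module.End.one_apply, regConst_z, mul_comm (a 0)]
    congr 1
    split_ifs with hc
    · refine Finset.sum_congr rfl fun j _ => ?_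
      rw [pow_succ, Module.End.mul_apply, z_reverse_cons, del_mul_zOne, if_pos hc]
    · refine (Finset.sum_eq_zero fun j _ => ?_).symm
      rw [pow_succ, Module.End.mul_apply, z_reverse_cons, del_mul_zOne, if_neg hc, map_zero,
        map_zero, zero_mul]

theorem del_pow_length (r : List ℕ+) : (del ^ (r.length + 1)) (z r.reverse) = 0 := by
  induction r with
  | nil => simp [z_nil, del_one]
  | cons a r ih =>
    rw [List.length_cons, pow_succ, Module.End.mul_apply, z_reverse_cons, del_mul_zOne]
    split
    · exact ih
    · exact map_zero _

/-- The regularization theorem at `T = 0`. -/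
theorem zetaReg_harmonic_eq_conv (r : List ℕ+) :
    zetaReg .harmonic r.reverse = conv regOnes (fun r => zetaReg .shuffle r.reverse) r := by
  rw [conv_shuffle_eq_sum, ← regConst_z, regConst_apply,
    regHom_harmonic_eq_sum _ _ (del_pow_length r), Polynomial.eval_finsetSum]
  refine Finset.sum_congr rfl fun j _ => ?_
  rw [Polynomial.eval_mul, Polynomial.eval_C]
  rfl


/-! ### The generating function of `ζ^∗(1, …, 1)` -/

theorem harmonic_zOne_powY_zero (a : ℕ+) : harmonic (zOne a) (powY 0) = zOne a := by
  rw [← z_singleton, powY, List.replicate_zero, harmonic_one_right]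

theorem harmonic_zOne_powY_succ (a : ℕ+) (m : ℕ) :
    harmonic (zOne a) (powY (m + 1)) =
      powY (m + 1) * zOne a + harmonic (zOne a) (powY m) * zOne 1 + powY m * zOne (a + 1) := by
  have h := harmonic_mul [] (List.replicate m 1) a 1
  have e : z (List.replicate m 1) * zOne 1 = powY (m + 1) := (powY_succ m).symm
  have h2 : harmonic (z []) (powY (m + 1)) = powY (m + 1) := harmonic_one_left _
  rw [e, h2, harmonic_one_left, z_nil, one_mul] at h
  exact h

/-- Newton's identity in the harmonic algebra. -/
theorem sum_harmonic_zOne_powY (n : ℕ) :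
    ∑ p ∈ Finset.HasAntidiagonal.antidiagonal n, (-1 : ℚ) ^ p.1 • harmonic (zOne p.1.succPNat) (powY p.2) =
      (n + 1 : ℚ) • powY (n + 1) := by
  induction n with
  | zero =>
    rw [Finset.HasAntidiagonal.antidiagonal_zero, Finset.sum_singleton, harmonic_zOne_powY_zero, powY_succ,
      powY_zero]
    simp
    rfl
  | succ n ih =>
    -- `h1` and `h2` split off opposite end terms of the same sum ∑ (-1)^i yʲ z_{i+1}. Comparing
    -- them cancels the contracted terms of the harmonic products and leaves one extra yⁿ⁺².
    have h1 := Finset.Nat.sum_antidiagonal_succ (n := n)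
      (f := fun p => (-1 : ℚ) ^ p.1 • (powY p.2 * zOne p.1.succPNat))
    have h2 := Finset.Nat.sum_antidiagonal_succ' (n := n)
      (f := fun p => (-1 : ℚ) ^ p.1 • (powY p.2 * zOne p.1.succPNat))
    have hs : ∀ i : ℕ, (i + 1).succPNat = i.succPNat + 1 := fun i => rfl
    have h0 : (0 : ℕ).succPNat = 1 := rfl
    simp only [hs, h0, powY_zero, one_mul, pow_zero, one_smul, pow_succ, mul_neg, mul_one,
      neg_smul, Finset.sum_neg_distrib] at h1 h2
    rw [Finset.Nat.sum_antidiagonal_succ']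
    simp only [harmonic_zOne_powY_zero, harmonic_zOne_powY_succ, smul_add,
      Finset.sum_add_distrib, ← smul_mul_assoc, ← Finset.sum_mul, ih, pow_succ, mul_neg, mul_one,
      neg_smul, hs] at h1 h2 ⊢
    rw [h1] at h2
    rw [smul_mul_assoc, ← powY_succ] at *
    push_cast
    rw [← add_assoc, ← add_assoc, ← h2]
    module

theorem regOnes_recursion (n : ℕ) :
    ((n + 1 : ℕ) : mzvAlg) * regOnes (n + 1) =
      ∑ p ∈ Finset.HasAntidiagonal.antidiagonal n,
        (-1) ^ p.1 * regConst .harmonic (zOne p.1.succPNat) * regOnes p.2 := by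
  have h := congrArg (regConst .harmonic) (sum_harmonic_zOne_powY n)
  have hp : ∀ u v, regConst .harmonic (harmonic u v) =
      regConst .harmonic u * regConst .harmonic v := regConst_prod .harmonic
  simp only [map_sum, map_smul, hp] at h
  have e : ∀ (c : ℚ) (x : mzvAlg), c • x = algebraMap ℚ mzvAlg c * x := fun c x =>
    Algebra.smul_def c x
  simp only [e, map_add, map_natCast, map_one, map_pow, map_neg] at h
  rw [regOnes, Nat.cast_add, Nat.cast_one, ← h]
  exact Finset.sum_congr rfl fun p _ => by rw [mul_assoc]; rfl

theorem regConst_of_admissible (s : Kind) (k : Index) (hk : Admissible k) :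
    regConst s (z k) = mzvZ k hk := by
  rw [regConst_apply, (isRegularization_regHom s).map_admissible k hk, Polynomial.eval_C]

theorem mzv_even (i : ℕ) (hi : i ≠ 0) (a : ℕ+) (ha : (a : ℕ) = 2 * i) :
    ∃ q : ℚ, mzv [a] = q * Real.pi ^ (2 * i) := by
  have ha1 : a ≠ 1 := by
    rintro rfl
    simp only [PNat.one_coe] at ha
    omega
  have h1 := hasSum_mzv ha1 []
  have h2 := (hasSum_nat_add_iff' 1).2 (hasSum_zeta_nat hi)
  have h3 : (0 : ℝ) ^ (2 * i) = 0 := zero_pow (by omega)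
  simp only [Finset.sum_range_one, Nat.cast_zero, h3, div_zero, sub_zero] at h2
  refine ⟨(-1) ^ (i + 1) * 2 ^ (2 * i - 1) * bernoulli (2 * i) / (2 * i).factorial, ?_⟩
  have h4 := h1.unique (h2.congr_fun fun n => by rw [hsum_nil, ha]; push_cast; rfl)
  rw [List.reverse_singleton] at h4
  rw [h4]
  push_cast
  ring

/-- The argument is i + 1, which is even, so Euler's formula gives a rational multiple of π^(i+1).
-/
theorem regConst_zOne_mem {i : ℕ} (hi : Odd i) :
    regConst .harmonic (zOne i.succPNat) ∈ piSqIdeal := by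
  obtain ⟨j, rfl⟩ := hi
  have hadm : Admissible [(2 * j + 1).succPNat] := by simp [Admissible]
  rw [← z_singleton, regConst_of_admissible _ _ hadm]
  obtain ⟨q, hq⟩ := mzv_even (j + 1) (by omega) (2 * j + 1).succPNat
    (by rw [Nat.succPNat_coe]; omega)
  have : mzvZ _ hadm = algebraMap ℚ mzvAlg q * piSq ^ j * piSq := by
    apply Subtype.ext
    change mzv _ = (q : ℝ) * (Real.pi ^ 2) ^ j * Real.pi ^ 2
    rw [hq]
    ring
  rw [this]
  exact Ideal.mul_mem_left _ _ (Ideal.subset_span rfl)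

/-- The power series `F(u) F(-u)` with `F(u) = ∑ ζ^∗(1, …, 1) uʲ` is `1` modulo `π²`. -/
theorem sum_regOnes_mem (n : ℕ) :
    ∑ p ∈ Finset.HasAntidiagonal.antidiagonal (n + 1), regOnes p.1 * ((-1) ^ p.2 * regOnes p.2) ∈ piSqIdeal := by
  let F : mzvAlg⟦X⟧ := PowerSeries.mk regOnes
  let F' : mzvAlg⟦X⟧ := PowerSeries.mk fun j => (-1) ^ j * regOnes j
  let c : ℕ → mzvAlg := fun i => regConst .harmonic (zOne i.succPNat)
  have hF : theta F = PowerSeries.X * (PowerSeries.mk (fun i => (-1) ^ i * c i) * F) := by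
    ext1 m
    rw [coeff_theta]
    cases m with
    | zero => simp
    | succ m =>
      rw [PowerSeries.coeff_succ_X_mul, PowerSeries.coeff_mk, regOnes_recursion,
        PowerSeries.coeff_mul]
      simp only [F, PowerSeries.coeff_mk, c]
  have hF' : theta F' = PowerSeries.X * (PowerSeries.mk (fun i => -c i) * F') := by
    ext1 m
    rw [coeff_theta]
    cases m with
    | zero => simp
    | succ m =>
      rw [PowerSeries.coeff_succ_X_mul, PowerSeries.coeff_mk, mul_left_comm, regOnes_recursion,
        PowerSeries.coeff_mul, Finset.mul_sum]
      refine Finset.sum_congr rfl fun p hp => ?_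
      rw [← Finset.HasAntidiagonal.mem_antidiagonal.1 hp]
      simp only [F', PowerSeries.coeff_mk, c]
      have : ((-1 : mzvAlg) ^ p.1) * (-1) ^ p.1 = 1 := by rw [← mul_pow]; simp
      rw [pow_succ, pow_add]
      linear_combination (-(-1) ^ p.2 * regConst .harmonic (zOne p.1.succPNat) * regOnes p.2) * this
  -- The logarithmic derivatives of F(u) and F(-u) add. The terms with i even, including the one
  -- with ζ^∗(1), cancel, and only zeta values at even arguments i + 1 remain.
  have hG : theta (F * F') =
      PowerSeries.X * (PowerSeries.mk (fun i => ((-1) ^ i - 1) * c i) * (F * F')) := by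
    have : (PowerSeries.mk (fun i => ((-1) ^ i - 1) * c i) : mzvAlg⟦X⟧) =
        PowerSeries.mk (fun i => (-1) ^ i * c i) + PowerSeries.mk (fun i => -c i) := by
      ext1 m
      simp only [map_add, PowerSeries.coeff_mk]
      ring
    rw [theta_mul, hF, hF', this]
    ring
  have hcoeff := congrArg (PowerSeries.coeff (n + 1)) hG
  rw [coeff_theta, PowerSeries.coeff_succ_X_mul, PowerSeries.coeff_mul n] at hcoeff
  have hmem : ((n + 1 : ℕ) : mzvAlg) * PowerSeries.coeff (n + 1) (F * F') ∈ piSqIdeal := by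
    rw [hcoeff]
    refine Ideal.sum_mem _ fun p _ => Ideal.mul_mem_right _ _ ?_
    rw [PowerSeries.coeff_mk]
    rcases Nat.even_or_odd p.1 with h | h
    · rw [h.neg_one_pow, sub_self, zero_mul]
      exact Ideal.zero_mem _
    · exact Ideal.mul_mem_left _ _ (regConst_zOne_mem h)
  -- The factor n + 1 produced by `theta` can be divided out inside the ideal because 𝒵 contains ℚ.
  have hinv : algebraMap ℚ mzvAlg (1 / (n + 1 : ℕ)) * ((n + 1 : ℕ) : mzvAlg) = 1 := by
    rw [← map_natCast (algebraMap ℚ mzvAlg), ← map_mul, one_div, inv_mul_cancel₀ (by positivity),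
      map_one]
  have h := Ideal.mul_mem_left piSqIdeal (algebraMap ℚ mzvAlg (1 / (n + 1 : ℕ))) hmem
  rw [← mul_assoc, hinv, one_mul, PowerSeries.coeff_mul] at h
  simpa only [F, F', PowerSeries.coeff_mk] using h

theorem regOnes_zero : regOnes 0 = 1 := by rw [regOnes, powY_zero, regConst_one]


/-! ### The operator that removes a leading `1` -/

section ShiftOp

variable {R : Type*} [CommRing R]

/-- `(shiftOp F)(1, r) = F(r)`, and `shiftOp F` vanishes elsewhere. -/
def shiftOp (F : List ℕ+ → R) : List ℕ+ → R
  | [] => 0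
  | c :: r => if c = 1 then F r else 0

theorem shiftOp_iterate_of_length_lt (F : List ℕ+ → R) (r : List ℕ+) (j : ℕ)
    (h : r.length < j) : shiftOp^[j] F r = 0 := by
  induction r generalizing j with
  | nil =>
    obtain ⟨j, rfl⟩ := Nat.exists_eq_succ_of_ne_zero (Nat.ne_of_gt h)
    rw [Function.iterate_succ_apply', shiftOp]
  | cons c r ih =>
    obtain ⟨j, rfl⟩ := Nat.exists_eq_succ_of_ne_zero (Nat.ne_of_gt (Nat.zero_lt_of_lt h))
    rw [Function.iterate_succ_apply', shiftOp, ih j (Nat.lt_of_succ_lt_succ h), ite_self]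

theorem conv_cons (a : ℕ → R) (f : List ℕ+ → R) (c : ℕ+) (r : List ℕ+) :
    conv a f (c :: r) = a 0 * f (c :: r) + if c = 1 then conv (fun j => a (j + 1)) f r else 0 :=
  rfl

theorem conv_eq_sum (a : ℕ → R) (F : List ℕ+ → R) (r : List ℕ+) (M : ℕ) (h : r.length < M) :
    conv a F r = ∑ j ∈ Finset.range M, a j * shiftOp^[j] F r := by
  induction r generalizing a M with
  | nil =>
    obtain ⟨M, rfl⟩ := Nat.exists_eq_succ_of_ne_zero (Nat.ne_of_gt h)
    rw [conv, Finset.sum_range_succ', Finset.sum_eq_zero, zero_add, Function.iterate_zero_apply]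
    intro j _
    rw [Function.iterate_succ_apply', shiftOp, mul_zero]
  | cons c r ih =>
    obtain ⟨M, rfl⟩ := Nat.exists_eq_succ_of_ne_zero (Nat.ne_of_gt (Nat.zero_lt_of_lt h))
    rw [conv, Finset.sum_range_succ', Function.iterate_zero_apply, add_comm,
      ih (fun j => a (j + 1)) M (Nat.lt_of_succ_lt_succ h)]
    congr 1
    split_ifs with hc
    · refine Finset.sum_congr rfl fun j _ => ?_
      rw [Function.iterate_succ_apply', shiftOp, if_pos hc]
    · refine (Finset.sum_eq_zero fun j _ => ?_).symm
      rw [Function.iterate_succ_apply', shiftOp, if_neg hc, mul_zero]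

/-- The signed sum over all ways to cut the index `k` into two parts. -/
def cutSum (F G : List ℕ+ → R) (k : Index) : R :=
  ∑ i ∈ Finset.range (k.length + 1),
    (-1) ^ wt (k.drop i) * F (k.take i).reverse * G (k.drop i)

/-- A 1 removed just left of a cut is the 1 removed just right of the preceding cut. The remaining
pieces agree, and the weight of the right part differs by 1, whence the sign. -/
theorem cutSum_shiftOp_left (F G : List ℕ+ → R) (k : Index) :
    cutSum (shiftOp F) G k = -cutSum F (shiftOp G) k := by
  rw [cutSum, cutSum, Finset.sum_range_succ', Finset.sum_range_succ, List.take_zero,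
    List.reverse_nil, List.drop_length, shiftOp, shiftOp, mul_zero, zero_mul, mul_zero, add_zero,
    add_zero, ← Finset.sum_neg_distrib]
  refine Finset.sum_congr rfl fun i hi => ?_
  have hi : i < k.length := Finset.mem_range.1 hi
  rw [List.drop_eq_getElem_cons hi, ← List.take_append_getElem hi, List.reverse_append,
    List.reverse_singleton, List.singleton_append, shiftOp, shiftOp]
  split_ifs with hc
  · have : wt (k[i] :: k.drop (i + 1)) = wt (k.drop (i + 1)) + 1 := by
      simp [wt, hc, add_comm]
    rw [this, pow_succ]
    ring
  · simp

theorem cutSum_shiftOp_iterate (F G : List ℕ+ → R) (k : Index) (p q : ℕ) :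
    cutSum (shiftOp^[p] F) (shiftOp^[q] G) k = (-1) ^ q * cutSum (shiftOp^[p + q] F) G k := by
  induction q generalizing p with
  | zero => simp
  | succ q ih =>
    rw [Function.iterate_succ_apply', ← neg_neg (cutSum _ _ _), ← cutSum_shiftOp_left,
      ← Function.iterate_succ_apply' shiftOp, ih, Nat.succ_eq_add_one, add_right_comm,
      add_assoc p q 1, pow_succ]
    ring

/-- `conv a` is the operator ∑ aⱼ Dʲ with D = `shiftOp`. Moving every D to the left piece costs
(-1)^q, and the terms are then collected by n = p + q. -/
theorem cutSum_conv (a : ℕ → R) (F G : List ℕ+ → R) (k : Index) :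
    cutSum (conv a F) (conv a G) k = ∑ n ∈ Finset.range (k.length + 1),
      (∑ p ∈ Finset.HasAntidiagonal.antidiagonal n, a p.1 * ((-1) ^ p.2 * a p.2)) *
        cutSum (shiftOp^[n] F) G k := by
  set M := k.length + 1 with hM
  have hvan : ∀ n, M ≤ n → cutSum (shiftOp^[n] F) G k = 0 := by
    intro n hn
    refine Finset.sum_eq_zero fun i _ => ?_
    rw [shiftOp_iterate_of_length_lt, mul_zero, zero_mul]
    rw [List.length_reverse, List.length_take]
    omega
  have h1 : cutSum (conv a F) (conv a G) k = ∑ p ∈ Finset.range M, ∑ q ∈ Finset.range M,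
      a p * a q * cutSum (shiftOp^[p] F) (shiftOp^[q] G) k := by
    simp only [cutSum, Finset.mul_sum]
    rw [Finset.sum_congr rfl fun p _ => Finset.sum_comm, Finset.sum_comm]
    refine Finset.sum_congr rfl fun i _ => ?_
    rw [conv_eq_sum a F _ M, conv_eq_sum a G _ M, mul_assoc, Finset.sum_mul_sum, Finset.mul_sum]
    · refine Finset.sum_congr rfl fun p _ => ?_
      rw [Finset.mul_sum]
      refine Finset.sum_congr rfl fun q _ => ?_
      ring
    · rw [List.length_drop]; omega
    · rw [List.length_reverse, List.length_take]; omega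
  have h2 : ∀ n, (∑ p ∈ Finset.HasAntidiagonal.antidiagonal n, a p.1 * ((-1) ^ p.2 * a p.2)) *
      cutSum (shiftOp^[n] F) G k = ∑ i ∈ Finset.range (n + 1),
        a i * ((-1) ^ (n - i) * a (n - i)) * cutSum (shiftOp^[i + (n - i)] F) G k := by
    intro n
    rw [Finset.Nat.sum_antidiagonal_eq_sum_range_succ_mk, Finset.sum_mul]
    refine Finset.sum_congr rfl fun i hi => ?_
    rw [Nat.add_sub_cancel' (Nat.lt_succ_iff.1 (Finset.mem_range.1 hi))]
  rw [h1, Finset.sum_congr rfl fun n _ => h2 n, Finset.sum_range_diag_flip M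
    fun p q => a p * ((-1) ^ q * a q) * cutSum (shiftOp^[p + q] F) G k]
  refine Finset.sum_congr rfl fun p _ => ?_
  -- The square of pairs (p, q) exceeds the triangle p + q < M only by terms with p + q ≥ M, in
  -- which more entries are removed than the index has.
  rw [← Finset.sum_subset (Finset.range_mono (Nat.sub_le M p))]
  · refine Finset.sum_congr rfl fun q _ => ?_
    rw [cutSum_shiftOp_iterate]
    ring
  · intro q _ hq
    rw [Finset.mem_range, not_lt] at hq
    rw [cutSum_shiftOp_iterate, hvan _ (by omega), mul_zero, mul_zero]

theorem cutSum_conv_sub_mem (I : Ideal R) (a : ℕ → R) (h0 : a 0 = 1)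
    (ha : ∀ n, ∑ p ∈ Finset.HasAntidiagonal.antidiagonal (n + 1),
      a p.1 * ((-1) ^ p.2 * a p.2) ∈ I) (F G : List ℕ+ → R) (k : Index) :
    cutSum (conv a F) (conv a G) k - cutSum F G k ∈ I := by
  rw [cutSum_conv, Finset.sum_range_succ']
  have : (∑ p ∈ Finset.HasAntidiagonal.antidiagonal 0, a p.1 * ((-1) ^ p.2 * a p.2)) *
      cutSum (shiftOp^[0] F) G k = cutSum F G k := by simp [h0]
  rw [this, add_sub_cancel_right]
  exact I.sum_mem fun n _ => I.mul_mem_right _ (ha n)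

end ShiftOp

/-! ### The series over all shifts of an index -/

section ShiftSeries

variable {R : Type*} [CommRing R]

/-- The series `∑_l b(k, l) f(k + l) t^{wt l}`. -/
noncomputable def shiftSeries (f : List ℕ+ → R) (k : Index) : R⟦X⟧ :=
  PowerSeries.mk fun n => ∑ l ∈ Finset.Nat.antidiagonalTuple k.length n,
    (k.b l : R) * f (k.shift l)

/-- The positive integer `c + n`. -/
def addNat (c : ℕ+) (n : ℕ) : ℕ+ := ⟨(c : ℕ) + n, Nat.add_pos_left c.pos _⟩

theorem addNat_eq_one_iff (c : ℕ+) (n : ℕ) : addNat c n = 1 ↔ c = 1 ∧ n = 0 := by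
  have := c.pos
  rw [← PNat.coe_eq_one_iff (m := c), ← PNat.coe_eq_one_iff]
  change (c : ℕ) + n = 1 ↔ _
  omega

theorem shift_cons (c : ℕ+) (k : Index) (l : Fin (k.length + 1) → ℕ) :
    Index.shift (c :: k) l = addNat c (l 0) :: Index.shift k (Fin.tail l) := by
  rw [Index.shift]
  exact List.ofFn_succ

theorem b_cons (c : ℕ+) (k : Index) (l : Fin (k.length + 1) → ℕ) :
    Index.b (c :: k) l = Nat.choose ((c : ℕ) + l 0 - 1) (l 0) * Index.b k (Fin.tail l) := by
  rw [Index.b]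
  exact Fin.prod_univ_succ _

theorem sum_antidiagonalTuple_head_zero (r n : ℕ) (g : (Fin r → ℕ) → R) :
    ∑ l ∈ Finset.Nat.antidiagonalTuple (r + 1) n, (if l 0 = 0 then g (Fin.tail l) else 0) =
      ∑ l ∈ Finset.Nat.antidiagonalTuple r n, g l := by
  rw [← Finset.sum_filter]
  refine Finset.sum_nbij' Fin.tail (Fin.cons (α := fun _ => ℕ) 0) ?_ ?_ ?_ ?_ ?_
  · intro l hl
    rw [Finset.mem_filter, Finset.Nat.mem_antidiagonalTuple, Fin.sum_univ_succ] at hl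
    rw [Finset.Nat.mem_antidiagonalTuple, ← hl.1, hl.2, zero_add]
    rfl
  · intro l hl
    rw [Finset.Nat.mem_antidiagonalTuple] at hl
    rw [Finset.mem_filter, Finset.Nat.mem_antidiagonalTuple, Fin.sum_univ_succ]
    simp [hl]
  · intro l hl
    rw [← (Finset.mem_filter.1 hl).2]
    exact Fin.cons_self_tail l
  · intro l _
    exact Fin.tail_cons _ _
  · intro l _
    rfl

/-- A shifted entry is removed only if it equals 1, which forces k_j = 1 and l_j = 0. Its binomial
coefficient is then 1 and it contributes no power of t, so the remaining sum is the series of the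
shorter index. -/
theorem shiftSeries_conv (a : ℕ → R) (f : List ℕ+ → R) (k : Index) :
    shiftSeries (conv a f) k = conv (fun j => PowerSeries.C (a j)) (shiftSeries f) k := by
  induction k generalizing a with
  | nil =>
    have hs : ∀ l, Index.shift [] l = [] := fun l => rfl
    ext n
    simp only [conv, shiftSeries, PowerSeries.coeff_C_mul, PowerSeries.coeff_mk, hs,
      Finset.mul_sum]
    exact Finset.sum_congr rfl fun l _ => by ring
  | cons c k ih =>
    rw [conv, ← ih fun j => a (j + 1)]
    have key : ∀ l : Fin (k.length + 1) → ℕ,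
        (Index.b (c :: k) l : R) * conv a f (Index.shift (c :: k) l) =
          a 0 * ((Index.b (c :: k) l : R) * f (Index.shift (c :: k) l)) +
            if c = 1 then (if l 0 = 0 then
              (Index.b k (Fin.tail l) : R) *
                conv (fun j => a (j + 1)) f (Index.shift k (Fin.tail l)) else 0) else 0 := by
      intro l
      rw [shift_cons, conv_cons, mul_add]
      congr 1
      · ring
      · simp only [addNat_eq_one_iff]
        by_cases hc : c = 1
        · by_cases hl : l 0 = 0
          · rw [if_pos ⟨hc, hl⟩, if_pos hc, if_pos hl, b_cons, hl]
            simp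
          · rw [if_neg fun h => hl h.2, if_pos hc, if_neg hl, mul_zero]
        · rw [if_neg fun h => hc h.1, if_neg hc, mul_zero]
    ext n
    rw [map_add, PowerSeries.coeff_C_mul, shiftSeries, PowerSeries.coeff_mk, shiftSeries,
      PowerSeries.coeff_mk, Finset.mul_sum]
    change ∑ l ∈ Finset.Nat.antidiagonalTuple (k.length + 1) n, _ = _
    rw [Finset.sum_congr rfl fun l _ => key l, Finset.sum_add_distrib]
    congr 1
    split_ifs with hc
    · rw [sum_antidiagonalTuple_head_zero k.length n fun l => (Index.b k l : R) *
        conv (fun j => a (j + 1)) f (Index.shift k l), shiftSeries, PowerSeries.coeff_mk]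
    · simp

end ShiftSeries

/-! ### Independence of the regularization -/

/-- Both pieces are read outwards from the cut: the left one is reversed by `cutSum`, and the right
one already enters ζ^• in reversed order. The trailing ones affected by regularization are thus the
leading entries of both lists. -/
theorem zetaS_eq_cutSum (s : Kind) (k : Index) :
    zetaS s k = cutSum (fun r => PowerSeries.C (zetaReg s r.reverse))
      (shiftSeries fun r => zetaReg s r.reverse) k := by
  simp only [zetaS, cutSum, List.reverse_reverse]
  rfl

theorem C_conv {R : Type*} [CommRing R] (a : ℕ → R) (f : List ℕ+ → R) (r : List ℕ+) :
    PowerSeries.C (conv a f r) = conv (fun j => PowerSeries.C (a j))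
      (fun r => PowerSeries.C (f r)) r := by
  induction r generalizing a with
  | nil => simp [conv]
  | cons c r ih =>
    rw [conv, conv, map_add, map_mul, ← ih fun j => a (j + 1)]
    split_ifs <;> simp

theorem C_mem_piSqIdealSeries {c : mzvAlg} (h : c ∈ piSqIdeal) :
    PowerSeries.C c ∈ piSqIdealSeries := by
  obtain ⟨d, rfl⟩ := Ideal.mem_span_singleton'.1 h
  rw [map_mul]
  exact Ideal.mul_mem_left _ _ (Ideal.subset_span rfl)

theorem zetaS_sub_mem (k : Index) :
    zetaS .harmonic k - zetaS .shuffle k ∈ piSqIdealSeries := by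
  have h1 : (fun r : List ℕ+ => zetaReg .harmonic r.reverse) =
      conv regOnes fun r => zetaReg .shuffle r.reverse := funext zetaReg_harmonic_eq_conv
  have h2 : (fun r : List ℕ+ => PowerSeries.C (zetaReg .harmonic r.reverse)) =
      conv (fun j => PowerSeries.C (regOnes j))
        fun r => PowerSeries.C (zetaReg .shuffle r.reverse) := funext fun r => by
    rw [zetaReg_harmonic_eq_conv, C_conv]
  have h3 : shiftSeries (fun r : List ℕ+ => zetaReg .harmonic r.reverse) =
      conv (fun j => PowerSeries.C (regOnes j))
        (shiftSeries fun r => zetaReg .shuffle r.reverse) := funext fun r => by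
    rw [h1, shiftSeries_conv]
  rw [zetaS_eq_cutSum, zetaS_eq_cutSum, h2, h3]
  refine cutSum_conv_sub_mem _ _ (by rw [regOnes_zero, map_one]) (fun n => ?_) _ _ _
  have := C_mem_piSqIdealSeries (sum_regOnes_mem n)
  simpa only [map_sum, map_mul, map_pow, map_neg, map_one] using this

theorem zetaSBar_eq (k : Index) : zetaSBar .harmonic k = zetaSBar .shuffle k := by
  obtain ⟨f, hf⟩ := Ideal.mem_span_singleton'.1 (zetaS_sub_mem k)
  have hpi : Ideal.Quotient.mk piSqIdeal piSq = 0 :=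
    Ideal.Quotient.eq_zero_iff_mem.2 (Ideal.subset_span rfl)
  rw [← sub_eq_zero, zetaSBar, zetaSBar, ← map_sub, ← hf, map_mul, PowerSeries.map_C, hpi,
    map_zero, mul_zero]

end SymMZV

theorem proposition2p1 :
    (∀ s : SymMZV.Kind, ∃! Z, SymMZV.IsRegularization s Z) ∧
    (∀ k : SymMZV.Index,
      SymMZV.zetaS .harmonic k - SymMZV.zetaS .shuffle k ∈ SymMZV.piSqIdealSeries) ∧
    (∀ k : SymMZV.Index, SymMZV.zetaSBar .harmonic k = SymMZV.zetaSBar .shuffle k) := by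
  refine ⟨fun s => ?_, SymMZV.zetaS_sub_mem, SymMZV.zetaSBar_eq⟩
  obtain ⟨Z, hZ⟩ := SymMZV.exists_isRegularization s
  exact ⟨Z, hZ, fun _ h => h.unique hZ⟩
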